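/- Fix constants $r\in(0,1)$ and $\pi_1,\pi_2>0$ with $\pi_1+\pi_2=1$. For each $n$ let $\lambda_n\le n$, and consider the stochastic block model on $n$ nodes in which the first $\bar n_1=n\pi_1$ nodes (rounded up or down to an integer) form a community and the remaining nodes form the background: the adjacency matrix $A$ is a random symmetric matrix with entries in $\{0,1\}$, whose entries $A_{ij}$, $i>j$, are independent Bernoulli variables with parameter $\lambda_n/n$ if $i$ and $j$ both belong to the community and $r\lambda_n/n$ otherwise (that is, the probability matrix is $\frac{\lambda_n}{n}\begin{pmatrix}1&r\\ r&\omega\end{pmatrix}$ with $\omega=r$; the diagonal of $A$ may be zero or not). Let $c\in\{-1,1\}^n$ be the true label vector, equal to $1$ on the community and $-1$ on the background. Assume that $\lambda_n$ grows at least as fast as $\log n$, i.e. $\lambda_n\ge C\log n$ for some constant $C>0$ and all large $n$. For $e\in\{-1,1\}^n$ let $n_1=\frac12(\mathbf 1+e)^T\mathbf 1$, $n_2=\frac12(\mathbf 1-e)^T\mathbf 1$, $O_{11}=\frac14(\mathbf 1+e)^TA(\mathbf 1+e)$, $O_{12}=\frac14(\mathbf 1+e)^TA(\mathbf 1-e)$,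 and let $$Q_{EX}(e)=\frac{n_2}{n_1}O_{11}-O_{12}\qquad(Q_{EX}(-\mathbf 1)=0)$$ be the community extraction criterion. Let $U_{\mathbb E[A]}$ be a $2\times n$ matrix whose rows are orthonormal eigenvectors of $\mathbb E[A]$ for its two largest eigenvalues. For a $2\times n$ matrix $U_A$, which may be computed from $A$, let $\mathcal E_A$ be the set of $e\in\{-1,1\}^n$ such that $U_Ae$ is an extreme point of $U_A[-1,1]^n$, and let $e^*\in\mathcal E_A$ be a maximizer of $Q_{EX}$ over $\mathcal E_A$. Write $\|\cdot\|$ for the Euclidean norm of vectors and the spectral norm of matrices. Then for every $\delta\in(0,1)$ there is a constant $M=M(r,\pi,\delta)>0$ such that, for all sufficiently large $n$, with probability at least $1-n^{-\delta}$, simultaneously for all $U_A$ and all maximizers $e^*$, $$\frac1n\|c-e^*\|^2\le M\left(\lambda_n^{-1/2}+\|U_A-U_{\mathbb E[A]}\|\right),$$ and, if the rows of $U_A$ are two orthonormal leading eigenvectors of $A$ (for its two largest eigenvalues), the fraction of mis-clustered nodes $\frac1n\#\{i: e^*_i\ne c_i\}$ is at most $M/\sqrt{\lambda_n}$. -/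

import Mathlib

open Filter MeasureTheory ProbabilityTheory
open scoped Matrix Matrix.Norms.L2Operator

namespace CommExtract

noncomputable section

/-! ### The stochastic block model with two communities -/

/-- The matrix of edge probabilities `(lam / n) * [[1, r], [r, ω]]` of a two-block model on `n` nodes
with degree parameter `lam`. -/
def blockProb (n : ℕ) (lam r ω : ℝ) : Matrix (Fin 2) (Fin 2) ℝ :=
  (lam / n) • !![1, r; r, ω]

/-- The community of each node: the first `n₁` nodes form community `0`, the others community `1`. -/
def community (n n₁ : ℕ) (i : Fin n) : Fin 2 := if i.val < n₁ then 0 else 1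

/-- The true label vector: `1` on the first `n₁` nodes and `-1` on the others. -/
def trueLabel (n n₁ : ℕ) (i : Fin n) : ℝ := if i.val < n₁ then 1 else -1

/-- `A` is a random adjacency matrix of the stochastic block model with communities `k` and
probability matrix `P`: symmetric, with entries in `{0, 1}`, whose entries strictly below the diagonal
are independent, the entry `(i, j)` being Bernoulli with parameter `P (k i) (k j)`.
Nothing is required of the diagonal, so that both usual conventions (no self-loops; Bernoulli
self-loops) are instances. -/
structure IsSBM {Ω : Type*} [MeasurableSpace Ω] (μ : Measure Ω) {n : ℕ}
    (P : Matrix (Fin 2) (Fin 2) ℝ) (k : Fin n → Fin 2)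
    (A : Ω → Matrix (Fin n) (Fin n) ℝ) : Prop where
  measurable : ∀ i j, Measurable (fun ω => A ω i j)
  zero_or_one : ∀ ω i j, A ω i j = 0 ∨ A ω i j = 1
  symm : ∀ ω, (A ω).IsSymm
  indep : iIndepFun (fun (p : {p : Fin n × Fin n // p.2 < p.1}) (ω : Ω) => A ω p.1.1 p.1.2) μ
  prob : ∀ i j, j < i → μ {ω | A ω i j = 1} = ENNReal.ofReal (P (k i) (k j))

/-- The entrywise expectation of a random matrix. -/
def expMatrix {Ω : Type*} [MeasurableSpace Ω] (μ : Measure Ω) {n : ℕ}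
    (A : Ω → Matrix (Fin n) (Fin n) ℝ) : Matrix (Fin n) (Fin n) ℝ :=
  Matrix.of fun i j => ∫ ω, A ω i j ∂μ

/-! ### Leading eigenvectors and the projected cube -/

/-- The rows of `U` are `m` leading eigenvectors of the symmetric matrix `B`: they are orthonormal
eigenvectors, and no eigenvector orthogonal to all of them has an eigenvalue exceeding one of
theirs (so that their eigenvalues are the `m` largest, with multiplicity). -/
structure IsLeadingEigenvectors {n m : ℕ} (B : Matrix (Fin n) (Fin n) ℝ)
    (U : Matrix (Fin m) (Fin n) ℝ) : Prop where
  orthonormal : U * Uᵀ = 1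
  exists_eigenvalues : ∃ ρ : Fin m → ℝ,
    (∀ k, B *ᵥ U k = ρ k • U k) ∧
    ∀ (x : Fin n → ℝ) (ν : ℝ), x ≠ 0 → U *ᵥ x = 0 → B *ᵥ x = ν • x → ∀ k, ν ≤ ρ k

/-- The projection `U [-1, 1]^n` of the cube. -/
def projectedCube {n m : ℕ} (U : Matrix (Fin m) (Fin n) ℝ) : Set (Fin m → ℝ) :=
  (fun x => U *ᵥ x) '' {x : Fin n → ℝ | ∀ i, x i ∈ Set.Icc (-1 : ℝ) 1}

/-- The label vectors `e ∈ {-1, 1}^n` whose projection `U e` is an extreme point of `U [-1, 1]^n`. -/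
def extremeLabels {n m : ℕ} (U : Matrix (Fin m) (Fin n) ℝ) : Set (Fin n → ℝ) :=
  {e | (∀ i, e i = 1 ∨ e i = -1) ∧ U *ᵥ e ∈ (projectedCube U).extremePoints ℝ}

/-! ### The community extraction criterion -/

/-- The number of nodes labelled `1`. -/
def size₁ {n : ℕ} (e : Fin n → ℝ) : ℝ := (1 / 2) * ((1 + e) ⬝ᵥ 1)

/-- The number of nodes labelled `-1`. -/
def size₂ {n : ℕ} (e : Fin n → ℝ) : ℝ := (1 / 2) * ((1 - e) ⬝ᵥ 1)

/-- The sum of the entries of `A` within the set labelled `1`. -/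
def O₁₁ {n : ℕ} (A : Matrix (Fin n) (Fin n) ℝ) (e : Fin n → ℝ) : ℝ :=
  (1 / 4) * ((1 + e) ⬝ᵥ (A *ᵥ (1 + e)))

/-- The sum of the entries of `A` between the sets labelled `1` and `-1`. -/
def O₁₂ {n : ℕ} (A : Matrix (Fin n) (Fin n) ℝ) (e : Fin n → ℝ) : ℝ :=
  (1 / 4) * ((1 + e) ⬝ᵥ (A *ᵥ (1 - e)))

/-- The community extraction criterion. For the empty community (`e = -1`) its value is `0`. -/
def qEX {n : ℕ} (A : Matrix (Fin n) (Fin n) ℝ) (e : Fin n → ℝ) : ℝ :=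
  size₂ e / size₁ e * O₁₁ A e - O₁₂ A e

/-- `e` maximizes the extraction criterion of `A` over the labels of the extreme points of the cube
projected by `U`. -/
def IsExtremeMaximizer {n m : ℕ} (A : Matrix (Fin n) (Fin n) ℝ) (U : Matrix (Fin m) (Fin n) ℝ)
    (e : Fin n → ℝ) : Prop :=
  e ∈ extremeLabels U ∧ ∀ e' ∈ extremeLabels U, qEX A e' ≤ qEX A e

end

end CommExtract

open CommExtract

namespace CommExtract
open Real

/-! ### Chernoff bounds for sums of independent Bernoulli variables -/

/-! Let `P` be `meanMatrix`, which has rank at most two, `W = A - P` the noise, λ the degree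
parameter and q = λ^(1/20), so that √λ = q^10. The diagonal of `W` has entries of size at most 1 and
costs only constants.

Noise. Off an event of probability 1/n, which is at most n^(-δ), the form of `W` on pairs of 0-1
vectors is O(n q^10), and the spectral norm of `W` is O(q^15) = O(λ^(3/4)) (`prob_not_isRegular_le`,
`abs_noise_cut_le`, `abs_noise_bilin_le`). The spectral bound is not sharp but suffices. It comes
from discrepancy q^14 √(|S||T|) on rectangles and row and column sums at most q^21, by cutting
vectors into dyadic levels; this costs a factor log q, absorbed in q.

A good competitor. The label vector is c = P z with |z|² = O(n/λ²). If the noise has norm at most b,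
the part of P z outside the two leading eigenvectors has squared length O(b²|z|²), with no eigengap
needed (`mulVec_residual_le`). For `A` this is O(q^30 n / q^40) = O(n/√λ); for `E[A]`, where b = 1,
it is smaller still, and replacing its eigenvectors by `U_A` adds O(n ‖U_A - U_E[A]‖). So c is close
to some `Uᵀ u`, and maximizing the functional u over the projected cube yields an extreme label e'
with few errors (`exists_extremeLabel_near`).

Comparison. Under `P` the criterion drops linearly in the number of errors (`gap_bounds`), and e*
does at least as well as e' under `A`. The criterion divides by the community size, so the
comparison is made twice (`ncard_ne_le_of_near_competitor`): the spectral bound, valid for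
communities of any size, shows that e* has a community of linear size; then the division is harmless
and the form on 0-1 vectors gives the error n q^10 / λ = n/√λ. -/

theorem integral_of_zero_or_one {Ω : Type*} [MeasurableSpace Ω] {μ : Measure Ω}
    [IsProbabilityMeasure μ] {X : Ω → ℝ} (hX : Measurable X) (h01 : ∀ ω, X ω = 0 ∨ X ω = 1)
    {p : ℝ} (hp : 0 ≤ p) (hprob : μ {ω | X ω = 1} = ENNReal.ofReal p) :
    Integrable X μ ∧ ∫ ω, X ω ∂μ = p := by
  have hm : MeasurableSet {ω | X ω = 1} := hX (measurableSet_singleton 1)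
  have hX' : X = Set.indicator {ω | X ω = 1} (fun _ => (1 : ℝ)) := by
    funext ω
    by_cases h : X ω = 1
    · rw [Set.indicator_of_mem (by exact h), h]
    · rw [Set.indicator_of_notMem (by exact h)]
      exact (h01 ω).resolve_right h
  have hi : Integrable (Set.indicator {ω | X ω = 1} (fun _ => (1 : ℝ))) μ :=
    (integrable_const 1).indicator hm
  refine ⟨hX' ▸ hi, ?_⟩
  rw [hX', integral_indicator_const _ hm, Measure.real, hprob,
    ENNReal.toReal_ofReal hp, smul_eq_mul, mul_one]

theorem exp_mul_centered_eq {x p θ : ℝ} (h : x = 0 ∨ x = 1) :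
    exp (θ * (x - p)) = exp (-(θ * p)) * (1 + (exp θ - 1) * x) := by
  rcases h with rfl | rfl
  · simp
  · rw [mul_one, add_sub_cancel, ← exp_add]; congr 1; ring

/-- The exponential is affine on {0, 1}, so the moment generating function is explicit, and `1 + x ≤
exp x` gives a Poisson-type bound. The factor p in the exponent keeps the variance scale of sparse
entries. -/
theorem mgf_centered_le {Ω : Type*} [MeasurableSpace Ω] {μ : Measure Ω}
    [IsProbabilityMeasure μ] {X : Ω → ℝ} (hX : Measurable X) (h01 : ∀ ω, X ω = 0 ∨ X ω = 1)
    {p : ℝ} (hp : 0 ≤ p) (hprob : μ {ω | X ω = 1} = ENNReal.ofReal p) (θ : ℝ) :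
    mgf (fun ω => X ω - p) μ θ ≤ exp (p * (exp θ - 1 - θ)) := by
  obtain ⟨hi, he⟩ := integral_of_zero_or_one hX h01 hp hprob
  have : mgf (fun ω => X ω - p) μ θ = exp (-(θ * p)) * (1 + (exp θ - 1) * p) := by
    unfold mgf
    simp_rw [fun ω => exp_mul_centered_eq (p := p) (θ := θ) (h01 ω)]
    rw [integral_const_mul, integral_add (integrable_const _) (hi.const_mul _),
      integral_const_mul, he]
    simp
  rw [this]
  have h1 : 1 + (exp θ - 1) * p ≤ exp ((exp θ - 1) * p) := by
    linarith [add_one_le_exp ((exp θ - 1) * p)]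
  calc _ ≤ exp (-(θ * p)) * exp ((exp θ - 1) * p) := by gcongr
    _ = _ := by rw [← exp_add]; congr 1; ring

/-- Equivalent to `θ ≤ sinh θ`. It lets the lower tail share the exponent of the upper tail. -/
theorem exp_neg_sub_le {θ : ℝ} (hθ : 0 ≤ θ) : exp (-θ) - 1 - -θ ≤ exp θ - 1 - θ := by
  have h := self_le_sinh_iff.2 hθ
  rw [sinh_eq] at h
  linarith

theorem chernoff_upper {Ω ι : Type*} [MeasurableSpace Ω] {μ : Measure Ω}
    [IsProbabilityMeasure μ] {X : ι → Ω → ℝ} (hX : ∀ i, Measurable (X i))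
    (h01 : ∀ i ω, X i ω = 0 ∨ X i ω = 1) (hind : iIndepFun X μ)
    {p : ι → ℝ} {ρ : ℝ} (hp : ∀ i, 0 ≤ p i) (hpρ : ∀ i, p i ≤ ρ)
    (hprob : ∀ i, μ {ω | X i ω = 1} = ENNReal.ofReal (p i)) (F : Finset ι) (s : ℝ)
    {θ : ℝ} (hθ : 0 ≤ θ) (hs : s = 1 ∨ s = -1) (D : ℝ) :
    μ.real {ω | D ≤ s * ∑ i ∈ F, (X i ω - p i)}
      ≤ exp (-θ * D + F.card * ρ * (exp θ - 1 - θ)) := by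
  have hs2 : ∀ ω, |s * ∑ i ∈ F, (X i ω - p i)| ≤ ∑ i ∈ F, (1 + ρ) := by
    intro ω
    have : |s| = 1 := by rcases hs with rfl | rfl <;> simp
    rw [abs_mul, this, one_mul]
    refine (Finset.abs_sum_le_sum_abs _ _).trans (Finset.sum_le_sum fun i _ => ?_)
    rw [abs_le]
    rcases h01 i ω with h | h <;> rw [h] <;> constructor <;> linarith [hp i, hpρ i]
  have hmeas : Measurable (fun ω => s * ∑ i ∈ F, (X i ω - p i)) :=
    (Finset.measurable_sum _ fun i _ => (hX i).sub_const _).const_mul _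
  have hint : Integrable (fun ω => exp (θ * (s * ∑ i ∈ F, (X i ω - p i)))) μ := by
    refine Integrable.of_bound (hmeas.const_mul θ).exp.aestronglyMeasurable
      (exp (θ * ∑ i ∈ F, (1 + ρ))) (ae_of_all _ fun ω => ?_)
    rw [norm_eq_abs, abs_exp]
    gcongr
    exact (le_abs_self _).trans (hs2 ω)
  refine (measure_ge_le_exp_mul_mgf D hθ hint).trans ?_
  have h1 : mgf (fun ω => s * ∑ i ∈ F, (X i ω - p i)) μ θ
      = ∏ i ∈ F, mgf (fun ω => X i ω - p i) μ (s * θ) := by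
    have hind' : iIndepFun (fun i ω => X i ω - p i) μ :=
      hind.comp (fun i x => x - p i) fun i => measurable_id.sub_const _
    rw [← hind'.mgf_sum (fun i => (hX i).sub_const _), mgf_const_mul]
    congr 1
    ext ω
    simp
  rw [h1, exp_add]
  gcongr
  have hφ : exp (s * θ) - 1 - s * θ ≤ exp θ - 1 - θ := by
    rcases hs with rfl | rfl
    · simp
    · simpa using exp_neg_sub_le hθ
  have hφ0 : 0 ≤ exp (s * θ) - 1 - s * θ := by linarith [add_one_le_exp (s * θ)]
  calc _ ≤ ∏ i ∈ F, exp (ρ * (exp θ - 1 - θ)) := by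
        refine Finset.prod_le_prod (fun i _ => mgf_nonneg) fun i _ => ?_
        refine (mgf_centered_le (hX i) (h01 i) (hp i) (hprob i) _).trans (exp_le_exp.2 ?_)
        exact mul_le_mul (hpρ i) hφ hφ0 ((hp i).trans (hpρ i))
    _ = _ := by rw [Finset.prod_const, ← exp_nat_mul]; congr 1; ring

theorem chernoff_abs {Ω ι : Type*} [MeasurableSpace Ω] {μ : Measure Ω}
    [IsProbabilityMeasure μ] {X : ι → Ω → ℝ} (hX : ∀ i, Measurable (X i))
    (h01 : ∀ i ω, X i ω = 0 ∨ X i ω = 1) (hind : iIndepFun X μ)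
    {p : ι → ℝ} {ρ : ℝ} (hp : ∀ i, 0 ≤ p i) (hpρ : ∀ i, p i ≤ ρ)
    (hprob : ∀ i, μ {ω | X i ω = 1} = ENNReal.ofReal (p i)) (F : Finset ι)
    {θ : ℝ} (hθ : 0 ≤ θ) (D : ℝ) :
    μ.real {ω | D ≤ |∑ i ∈ F, (X i ω - p i)|}
      ≤ 2 * exp (-θ * D + F.card * ρ * (exp θ - 1 - θ)) := by
  have hsub : {ω | D ≤ |∑ i ∈ F, (X i ω - p i)|} ⊆
      {ω | D ≤ 1 * ∑ i ∈ F, (X i ω - p i)} ∪ {ω | D ≤ -1 * ∑ i ∈ F, (X i ω - p i)} := by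
    intro ω hω
    simpa [le_abs] using hω
  have h1 := chernoff_upper hX h01 hind hp hpρ hprob F 1 hθ (Or.inl rfl) D
  have h2 := chernoff_upper hX h01 hind hp hpρ hprob F (-1) hθ (Or.inr rfl) D
  have h3 := (measureReal_mono hsub).trans (measureReal_union_le (μ := μ) _ _)
  linarith

/-! ### The centered lower triangle of the adjacency matrix -/

/-- The entries of `A - P` strictly below the diagonal. -/
noncomputable def lowerPart {n : ℕ} (B P : Matrix (Fin n) (Fin n) ℝ) : Matrix (Fin n) (Fin n) ℝ :=
  Matrix.of fun i j => if j < i then B i j - P i j else 0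

/-- The sum of the entries of `L` in the rectangle `S × T`. -/
noncomputable def cut {n : ℕ} (L : Matrix (Fin n) (Fin n) ℝ) (S T : Finset (Fin n)) : ℝ :=
  ∑ i ∈ S, ∑ j ∈ T, L i j

/-- The expectation of the adjacency matrix away from its diagonal. -/
noncomputable def meanMatrix (n n₁ : ℕ) (lam r : ℝ) : Matrix (Fin n) (Fin n) ℝ :=
  Matrix.of fun i j => blockProb n lam r r (community n n₁ i) (community n n₁ j)

theorem meanMatrix_nonneg {n n₁ : ℕ} {lam r : ℝ} (hlam : 0 ≤ lam) (hr₀ : 0 ≤ r)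
    (i j : Fin n) : 0 ≤ meanMatrix n n₁ lam r i j := by
  have : 0 ≤ lam / n := by positivity
  simp only [meanMatrix, blockProb, community, Matrix.of_apply, Matrix.smul_apply]
  split_ifs <;> simp <;> positivity

theorem meanMatrix_le {n n₁ : ℕ} {lam r : ℝ} (hlam : 0 ≤ lam) (hr₁ : r ≤ 1)
    (i j : Fin n) : meanMatrix n n₁ lam r i j ≤ lam / n := by
  have : 0 ≤ lam / n := by positivity
  simp only [meanMatrix, blockProb, community, Matrix.of_apply, Matrix.smul_apply]
  split_ifs <;> simp <;> nlinarith

/-- Only the pairs `j < i` of `S × T` contribute, and these entries are independent. This is why the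
strictly lower triangle is studied instead of the symmetric matrix. -/
theorem prob_cut_ge {Ω : Type*} [MeasurableSpace Ω] {μ : Measure Ω}
    [IsProbabilityMeasure μ] {n n₁ : ℕ} {lam r : ℝ} (hlam : 0 ≤ lam) (hr₀ : 0 ≤ r) (hr₁ : r ≤ 1)
    {A : Ω → Matrix (Fin n) (Fin n) ℝ} (hA : IsSBM μ (blockProb n lam r r) (community n n₁) A)
    (S T : Finset (Fin n)) {θ : ℝ} (hθ : 0 ≤ θ) (D : ℝ) :
    μ.real {ω | D ≤ |cut (lowerPart (A ω) (meanMatrix n n₁ lam r)) S T|}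
      ≤ 2 * exp (-θ * D + S.card * T.card * (lam / n) * (exp θ - 1 - θ)) := by
  classical
  set F : Finset {p : Fin n × Fin n // p.2 < p.1} := (S ×ˢ T).subtype _ with hF
  have hcard : F.card ≤ S.card * T.card := by
    rw [hF, Finset.card_subtype, ← Finset.card_product]
    exact Finset.card_filter_le _ _
  have hcut : ∀ ω, cut (lowerPart (A ω) (meanMatrix n n₁ lam r)) S T
      = ∑ p ∈ F, (A ω p.1.1 p.1.2 - meanMatrix n n₁ lam r p.1.1 p.1.2) := by
    intro ω
    rw [hF, Finset.sum_subtype_eq_sum_filter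
      (f := fun p : Fin n × Fin n => A ω p.1 p.2 - meanMatrix n n₁ lam r p.1 p.2),
      Finset.sum_filter, Finset.sum_product]
    rfl
  simp_rw [hcut]
  refine (chernoff_abs (fun p => hA.measurable _ _) (fun p ω => hA.zero_or_one _ _ _) hA.indep
    (p := fun p => meanMatrix n n₁ lam r p.1.1 p.1.2) (ρ := lam / n)
    (fun p => meanMatrix_nonneg hlam hr₀ _ _) (fun p => meanMatrix_le hlam hr₁ _ _)
    (fun p => hA.prob _ _ p.2) F hθ D).trans ?_
  have h0 : 0 ≤ exp θ - 1 - θ := by linarith [add_one_le_exp θ]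
  have h1 : (0:ℝ) ≤ lam / n := by positivity
  have h2 : (F.card : ℝ) ≤ S.card * T.card := by exact_mod_cast hcard
  gcongr

/-! ### Entropy bounds for the number of subsets -/

/-- The function `s * log (e * n / s)`, whose exponential bounds the number of `s`-subsets. -/
noncomputable def ent (n s : ℝ) : ℝ := s * (1 + log (n / s))

/-- The derivative in `s` is `log (n / s)`, nonnegative up to `n`; the proof uses `log x ≤ x - 1`
instead. -/
theorem ent_mono {n s t : ℝ} (hs : 0 < s) (hst : s ≤ t) (htn : t ≤ n) : ent n s ≤ ent n t := by
  have ht : 0 < t := hs.trans_le hst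
  have hn : 0 < n := ht.trans_le htn
  unfold ent
  have h1 : log (n / s) = log (n / t) + log (t / s) := by
    rw [← log_mul (by positivity) (by positivity)]; congr 1; field_simp
  have h2 : log (t / s) ≤ t / s - 1 := log_le_sub_one_of_pos (by positivity)
  have h3 : 0 ≤ log (n / t) := log_nonneg ((one_le_div ht).2 htn)
  have h4 : s * log (t / s) ≤ t - s := by
    calc _ ≤ s * (t / s - 1) := by gcongr
      _ = _ := by field_simp
  rw [h1]
  nlinarith

theorem choose_le_exp_ent {n s : ℕ} (hs : 0 < s) (hsn : s ≤ n) :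
    (n.choose s : ℝ) ≤ exp (ent n s) := by
  have hs' : (0:ℝ) < s := by exact_mod_cast hs
  have hn' : (0:ℝ) < n := by exact_mod_cast hs.trans_le hsn
  have h1 : exp (ent n s) = exp s * ((n:ℝ) / s) ^ s := by
    unfold ent
    rw [mul_add, mul_one, exp_add, ← exp_log (show (0:ℝ) < n / s by positivity), ← exp_nat_mul,
      log_exp]
  have h2 : (s:ℝ) ^ s / s.factorial ≤ exp s := pow_div_factorial_le_exp _ hs'.le s
  have h3 := Nat.choose_le_pow_div (α := ℝ) s n
  rw [h1]
  refine h3.trans ?_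
  calc (n:ℝ) ^ s / s.factorial = ((s:ℝ) ^ s / s.factorial) * ((n:ℝ) / s) ^ s := by
        rw [div_pow]; field_simp
    _ ≤ _ := by gcongr

/-- There are at most `exp (ent n s)` subsets of size s, so each size contributes at most `exp (-3 *
ent n s)`. Since `ent n s ≥ ent n 1 ≥ log n`, this is at most 1/n², and there are n sizes. -/
theorem sum_exp_neg_ent_le {n : ℕ} (hn : 0 < n) :
    ∑ S : Finset (Fin n), (if S.Nonempty then exp (-4 * ent n S.card) else 0) ≤ (n:ℝ)⁻¹ := by
  have hn' : (0:ℝ) < n := by exact_mod_cast hn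
  have h1 := Finset.sum_powerset_apply_card
    (fun s => if s = 0 then (0:ℝ) else exp (-4 * ent n s)) (x := (Finset.univ : Finset (Fin n)))
  have h2 : ∑ S : Finset (Fin n), (if S.Nonempty then exp (-4 * ent n S.card) else 0)
      = ∑ m ∈ (Finset.univ : Finset (Fin n)).powerset,
        (fun s : ℕ => if s = 0 then (0:ℝ) else exp (-4 * ent n s)) m.card := by
    rw [Finset.powerset_univ]
    refine Finset.sum_congr rfl fun S _ => ?_
    by_cases h : S.Nonempty
    · simp [h, h.ne_empty]
    · simp [Finset.not_nonempty_iff_eq_empty.1 h]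
  rw [h2, h1, Finset.card_univ, Fintype.card_fin, Finset.sum_range_succ']
  simp only [↓reduceIte, smul_zero, add_zero, Nat.succ_ne_zero]
  calc _ ≤ ∑ k ∈ Finset.range n, ((n:ℝ)⁻¹) ^ 2 := by
        refine Finset.sum_le_sum fun k hk => ?_
        have hk' : k + 1 ≤ n := by simpa using hk
        have hc := choose_le_exp_ent (Nat.succ_pos k) hk'
        have he : log n ≤ ent n ((k+1 : ℕ):ℝ) := by
          refine le_trans ?_ (ent_mono one_pos (by simp) (by exact_mod_cast hk'))
          simp [ent]
        have h0 : 0 ≤ log (n:ℝ) := log_natCast_nonneg n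
        rw [nsmul_eq_mul]
        calc _ ≤ exp (ent n ((k+1 : ℕ):ℝ)) * exp (-4 * ent n ((k+1:ℕ):ℝ)) := by gcongr
          _ = exp (-3 * ent n ((k+1 : ℕ):ℝ)) := by rw [← exp_add]; congr 1; ring
          _ ≤ exp (2 * (-log n)) := exp_le_exp.2 (by linarith)
          _ = _ := by rw [two_mul, exp_add, exp_neg, exp_log hn']; ring
    _ = _ := by
        rw [Finset.sum_const, Finset.card_range, nsmul_eq_mul]; field_simp

theorem exp_sub_one_sub_le_sq {θ : ℝ} (h0 : 0 ≤ θ) (h1 : θ ≤ 1) : exp θ - 1 - θ ≤ θ ^ 2 :=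
  (le_abs_self _).trans (abs_exp_sub_one_sub_id_le (by rwa [abs_of_nonneg h0]))

/-- A choice of the Chernoff parameter that beats the entropy of pairs of subsets of comparable
sizes `s` and `t`. -/
theorem exists_chernoff_parameter {q n s t : ℝ} (hq2 : 2 ≤ q) (hq : 32 * (1 + 20 * log q) ≤ q)
    (hs : 1 ≤ s) (ht : 1 ≤ t) (hsn : s ≤ n) (htn : t ≤ n)
    (hbal : max s t ≤ q ^ 7 * √(s * t)) :
    ∃ θ, 0 ≤ θ ∧ -θ * (q ^ 14 * √(s * t)) + s * t * (q ^ 20 / n) * (exp θ - 1 - θ)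
      ≤ -8 * ent n (max s t) := by
  set m := max s t with hm
  set g := √(s * t) with hg
  have hq0 : 0 < q := by linarith
  have hst : g ^ 2 = s * t := sq_sqrt (by positivity)
  have hm1 : 1 ≤ m := hs.trans (le_max_left _ _)
  have hm0 : 0 < m := by linarith
  have hmn : m ≤ n := max_le hsn htn
  have hn0 : 0 < n := by linarith
  have hg0 : 0 ≤ g := sqrt_nonneg _
  have hgm : g ≤ m := by
    rw [hg, sqrt_le_left hm0.le, sq]
    exact mul_le_mul (le_max_left _ _) (le_max_right _ _) (by linarith) hm0.le
  rw [← hst]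
  have hlog0 : 0 ≤ log (n / m) := log_nonneg ((one_le_div hm0).2 hmn)
  -- Small sets first. Here `exp θ` is of order √(n/m), so the exponential term costs only 2 q^10 g,
  -- at most half of the linear term θ q^14 g; by balance the other half dominates 16 θ m = 8 `ent n
  -- m`.
  rcases le_total (q ^ 20 * m) n with h | h
  · set θ := (1 + log (n / m)) / 2 with hθ
    have hθ1 : 1 / 2 ≤ θ := by rw [hθ]; linarith
    refine ⟨θ, by linarith, ?_⟩
    have hent : ent n m = 2 * θ * m := by rw [ent, hθ]; ring
    set E := exp θ with hE
    have hE0 : 0 < E := exp_pos _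
    have hE2 : E ^ 2 ≤ 4 * (n / m) := by
      rw [hE, ← exp_nat_mul, hθ]
      have : ((2:ℕ):ℝ) * ((1 + log (n / m)) / 2) = 1 + log (n / m) := by push_cast; ring
      rw [this, exp_add, exp_log (by positivity)]
      have : exp 1 ≤ 4 := by linarith [exp_one_lt_d9]
      gcongr
    have hEb : m * (q ^ 20 / n) * E ≤ 2 * q ^ 10 := by
      refine abs_le_of_sq_le_sq' ?_ (by positivity) |>.2
      calc (m * (q ^ 20 / n) * E) ^ 2 = (m * (q ^ 20 / n)) ^ 2 * E ^ 2 := by ring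
        _ ≤ (m * (q ^ 20 / n)) ^ 2 * (4 * (n / m)) := by gcongr
        _ = 4 * q ^ 20 * (q ^ 20 * m / n) := by field_simp
        _ ≤ 4 * q ^ 20 * 1 := by
            gcongr
            exact (div_le_one hn0).2 h
        _ = _ := by ring
    have h1 : g ^ 2 * (q ^ 20 / n) * (E - 1 - θ) ≤ g * (2 * q ^ 10) := by
      calc _ ≤ g ^ 2 * (q ^ 20 / n) * E := by gcongr; linarith
        _ = g * (g * (q ^ 20 / n) * E) := by ring
        _ ≤ g * (m * (q ^ 20 / n) * E) := by gcongr
        _ ≤ _ := by gcongr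
    have hq4 : 8 ≤ q ^ 4 := by
      calc (8:ℝ) ≤ 2 ^ 4 := by norm_num
        _ ≤ q ^ 4 := by gcongr
    have h2 : 2 * q ^ 10 ≤ θ / 2 * q ^ 14 := by
      calc 2 * q ^ 10 = 1/2/2 * (8 * q ^ 10) := by ring
        _ ≤ θ / 2 * (q ^ 4 * q ^ 10) := by gcongr
        _ = _ := by ring
    have hq7 : 32 ≤ q ^ 7 := by
      calc (32:ℝ) ≤ 2 ^ 7 := by norm_num
        _ ≤ q ^ 7 := by gcongr
    have h3 : 16 * m ≤ 1 / 2 * q ^ 14 * g := by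
      calc 16 * m ≤ 16 * (q ^ 7 * g) := by gcongr
        _ = 1 / 2 * (32 * (q ^ 7 * g)) := by ring
        _ ≤ 1 / 2 * (q ^ 7 * (q ^ 7 * g)) := by gcongr
        _ = _ := by ring
    rw [hent]
    have h4 : g * (2 * q ^ 10) ≤ g * (θ / 2 * q ^ 14) := by gcongr
    have h5 : θ * (16 * m) ≤ θ * (1 / 2 * q ^ 14 * g) := by gcongr
    nlinarith
  · have hlq : 0 ≤ log q := log_nonneg (by linarith)
    -- Minimizer of -θ q^14 + θ² q^20. For these large sets `ent n m` is at most m (1 + 20 log q),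
    -- which the gain g q^8 / 4 ≥ q m / 4 beats.
    set θ := (q ^ 6)⁻¹ / 2 with hθ
    have hθ0 : 0 ≤ θ := by positivity
    have hθq : θ * q ^ 6 = 1 / 2 := by rw [hθ]; field_simp
    have hθ1 : θ ≤ 1 := by
      have : (q ^ 6)⁻¹ ≤ 1 := inv_le_one_of_one_le₀ (one_le_pow₀ (by linarith))
      linarith
    refine ⟨θ, hθ0, ?_⟩
    have h1 : g ^ 2 * (q ^ 20 / n) * (exp θ - 1 - θ) ≤ g * q ^ 20 * θ ^ 2 := by
      have hgn : g / n ≤ 1 := (div_le_one hn0).2 (hgm.trans hmn)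
      calc _ ≤ g ^ 2 * (q ^ 20 / n) * θ ^ 2 := by
            gcongr
            exact exp_sub_one_sub_le_sq hθ0 hθ1
        _ = g * q ^ 20 * θ ^ 2 * (g / n) := by ring
        _ ≤ g * q ^ 20 * θ ^ 2 * 1 := by gcongr
        _ = _ := by ring
    have h2 : -θ * (q ^ 14 * g) + g * q ^ 20 * θ ^ 2 = - (g * q ^ 8 / 4) := by
      have e1 : θ * q ^ 14 = q ^ 8 / 2 := by
        calc θ * q ^ 14 = (θ * q ^ 6) * q ^ 8 := by ring
          _ = _ := by rw [hθq]; ring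
      have e2 : q ^ 20 * θ ^ 2 = q ^ 8 / 4 := by
        calc q ^ 20 * θ ^ 2 = (θ * q ^ 6) ^ 2 * q ^ 8 := by ring
          _ = _ := by rw [hθq]; ring
      calc _ = -(g * (θ * q ^ 14)) + g * (q ^ 20 * θ ^ 2) := by ring
        _ = _ := by rw [e1, e2]; ring
    have h3 : q * m ≤ g * q ^ 8 := by
      calc q * m ≤ q * (q ^ 7 * g) := by gcongr
        _ = _ := by ring
    have h4 : log (n / m) ≤ 20 * log q := by
      have : log (n / m) ≤ log (q ^ 20) := by
        apply log_le_log (by positivity)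
        rwa [div_le_iff₀ hm0]
      rwa [log_pow] at this
    have h5 : 8 * ent n m ≤ q * m / 4 := by
      unfold ent
      have : m * (32 * (1 + log (n / m))) ≤ m * q := by
        gcongr
        linarith
      linarith
    linarith

/-- The discrepancy properties of the centered lower triangle that hold with high probability. -/
structure IsRegular {n : ℕ} (q : ℝ) (L : Matrix (Fin n) (Fin n) ℝ) : Prop where
  cut_le : ∀ S T, |cut L S T| ≤ 4 * n * q ^ 10
  row_le : ∀ i, ∑ j, |L i j| ≤ q ^ 21
  col_le : ∀ j, ∑ i, |L i j| ≤ q ^ 21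
  disc_le : ∀ S T, |cut L S T| ≤ q ^ 14 * √(S.card * T.card)

theorem measureReal_exists_le {Ω ι : Type*} [MeasurableSpace Ω] {μ : Measure Ω} [Fintype ι]
    (B : ι → Ω → Prop) : μ.real {ω | ∃ i, B i ω} ≤ ∑ i, μ.real {ω | B i ω} := by
  rw [Set.ofPred_exists]
  exact measureReal_iUnion_fintype_le _

theorem eight_mul_le_four_pow {n : ℕ} (hn : 3 ≤ n) : 8 * n ≤ 4 ^ n := by
  induction n, hn using Nat.le_induction with
  | base => norm_num
  | succ k hk ih => rw [pow_succ]; lia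

/-! ### Union bounds: the regular event -/

section Union

variable {Ω : Type*} [MeasurableSpace Ω] {μ : Measure Ω} [IsProbabilityMeasure μ]
  {n n₁ : ℕ} {q r : ℝ} {A : Ω → Matrix (Fin n) (Fin n) ℝ}

/-- With θ = q^(-10) the exponent is at most -4n + n = -3n, and `exp (-3) ≤ 1 / 16` beats the 4^n
pairs of subsets. -/
theorem prob_cut_gt (hq1 : 1 ≤ q) (hr₀ : 0 ≤ r) (hr₁ : r ≤ 1) (hn : 3 ≤ n)
    (hA : IsSBM μ (blockProb n (q ^ 20) r r) (community n n₁) A) :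
    μ.real {ω | ∃ p : Finset (Fin n) × Finset (Fin n),
      4 * n * q ^ 10 ≤ |cut (lowerPart (A ω) (meanMatrix n n₁ (q ^ 20) r)) p.1 p.2|}
      ≤ (4 * n : ℝ)⁻¹ := by
  have hq0 : 0 < q := by linarith
  have hn0 : (0:ℝ) < n := by positivity
  refine (measureReal_exists_le _).trans ?_
  have hθ1 : (q ^ 10)⁻¹ ≤ 1 := inv_le_one_of_one_le₀ (one_le_pow₀ hq1)
  have key : ∀ p : Finset (Fin n) × Finset (Fin n), μ.real {ω | 4 * n * q ^ 10 ≤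
      |cut (lowerPart (A ω) (meanMatrix n n₁ (q ^ 20) r)) p.1 p.2|} ≤ 2 * exp (-3) ^ n := by
    intro p
    refine (prob_cut_ge (by positivity) hr₀ hr₁ hA p.1 p.2
      (θ := (q ^ 10)⁻¹) (by positivity) _).trans ?_
    rw [← exp_nat_mul]
    gcongr
    have c1 : (p.1.card : ℝ) ≤ n := by exact_mod_cast (Finset.card_le_univ _).trans_eq (by simp)
    have c2 : (p.2.card : ℝ) ≤ n := by exact_mod_cast (Finset.card_le_univ _).trans_eq (by simp)
    have : (p.1.card : ℝ) * p.2.card * (q ^ 20 / n) * (exp (q ^ 10)⁻¹ - 1 - (q ^ 10)⁻¹) ≤ n := by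
      calc _ ≤ (n : ℝ) * n * (q ^ 20 / n) * ((q ^ 10)⁻¹) ^ 2 := by
            gcongr
            · linarith [add_one_le_exp (q ^ 10)⁻¹]
            · exact exp_sub_one_sub_le_sq (by positivity) hθ1
        _ = n := by field_simp
    have e : -(q ^ 10)⁻¹ * (4 * n * q ^ 10) = -4 * n := by field_simp
    rw [e]
    linarith
  refine (Finset.sum_le_sum fun p _ => key p).trans ?_
  rw [Finset.sum_const, Finset.card_univ, Fintype.card_prod, Fintype.card_finset, Fintype.card_fin,
    nsmul_eq_mul]
  have he : exp (-3) ≤ 1 / 16 := by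
    rw [exp_neg, inv_eq_one_div]
    apply one_div_le_one_div_of_le (by norm_num)
    have h := exp_one_gt_d9
    calc (16:ℝ) ≤ 2.7 ^ 3 := by norm_num
      _ ≤ exp 1 ^ 3 := by gcongr; linarith
      _ = exp 3 := by rw [← exp_nat_mul]; norm_num
  have h8 : 8 * (n:ℝ) ≤ 4 ^ n := by exact_mod_cast eight_mul_le_four_pow hn
  calc ((2 ^ n * 2 ^ n : ℕ):ℝ) * (2 * exp (-3) ^ n) ≤ ((2 ^ n * 2 ^ n : ℕ):ℝ) * (2 * (1 / 16) ^ n) := by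
        gcongr
    _ = 2 * (4 ^ n)⁻¹ := by
        push_cast
        rw [← mul_pow, mul_left_comm, ← mul_pow, ← inv_pow]
        norm_num
    _ ≤ 2 * (8 * (n:ℝ))⁻¹ := by gcongr
    _ = _ := by field_simp; norm_num

/-- Meant for single rows and columns. With θ = 1 the exponent is at most -q^21/2 + q^20 ≤ -q^21/4 ≤
-4 log n, leaving room for a union over n lines. -/
theorem prob_line_gt (hq : 4 ≤ q) (hr₀ : 0 ≤ r) (hr₁ : r ≤ 1) (hn : 4 ≤ n)
    (hlog : 16 * log n ≤ q ^ 21)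
    (hA : IsSBM μ (blockProb n (q ^ 20) r r) (community n n₁) A)
    (S T : Fin n → Finset (Fin n)) (hST : ∀ i, (S i).card * (T i).card ≤ n) :
    μ.real {ω | ∃ i, q ^ 21 / 2 ≤
      |cut (lowerPart (A ω) (meanMatrix n n₁ (q ^ 20) r)) (S i) (T i)|} ≤ (8 * n : ℝ)⁻¹ := by
  have hq0 : 0 < q := by linarith
  have hn0 : (0:ℝ) < n := by positivity
  refine (measureReal_exists_le _).trans ?_
  have key : ∀ i, μ.real {ω | q ^ 21 / 2 ≤
      |cut (lowerPart (A ω) (meanMatrix n n₁ (q ^ 20) r)) (S i) (T i)|} ≤ 2 * ((n:ℝ) ^ 4)⁻¹ := by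
    intro i
    refine (prob_cut_ge (by positivity) hr₀ hr₁ hA _ _ (θ := 1) zero_le_one _).trans ?_
    have c : ((S i).card : ℝ) * (T i).card ≤ n := by exact_mod_cast hST i
    have e1 : exp 1 - 1 - 1 ≤ 1 := by linarith [exp_one_lt_d9]
    have e0 : 0 ≤ exp 1 - 1 - 1 := by linarith [exp_one_gt_d9]
    have : ((S i).card : ℝ) * (T i).card * (q ^ 20 / n) * (exp 1 - 1 - 1) ≤ q ^ 20 := by
      calc _ ≤ (n:ℝ) * (q ^ 20 / n) * 1 := by gcongr
        _ = _ := by field_simp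
    have h21 : 4 * q ^ 20 ≤ q ^ 21 := by
      rw [show q ^ 21 = q * q ^ 20 by ring]
      gcongr
    have : exp (-log n) ^ 4 = ((n:ℝ) ^ 4)⁻¹ := by rw [exp_neg, exp_log hn0, inv_pow]
    rw [← this, ← exp_nat_mul]
    gcongr
    push_cast
    linarith
  refine (Finset.sum_le_sum fun p _ => key p).trans ?_
  rw [Finset.sum_const, Finset.card_univ, Fintype.card_fin, nsmul_eq_mul]
  have : (4:ℝ) ≤ n := by exact_mod_cast hn
  have e1 : (n:ℝ) * (2 * ((n:ℝ) ^ 4)⁻¹) = 2 * ((n:ℝ) ^ 3)⁻¹ := by field_simp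
  have e2 : (8 * (n:ℝ))⁻¹ = 2 * (16 * (n:ℝ))⁻¹ := by field_simp; norm_num
  rw [e1, e2]
  gcongr
  calc 16 * (n:ℝ) = 4 ^ 2 * n := by norm_num
    _ ≤ (n:ℝ) ^ 2 * n := by gcongr
    _ = _ := by ring

/-- Only balanced pairs need probability; `isRegular_of_bounds` treats the others deterministically.
-/
theorem prob_disc_gt (hq2 : 2 ≤ q) (hq : 32 * (1 + 20 * log q) ≤ q) (hr₀ : 0 ≤ r) (hr₁ : r ≤ 1)
    (hn : 8 ≤ n) (hA : IsSBM μ (blockProb n (q ^ 20) r r) (community n n₁) A) :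
    μ.real {ω | ∃ p : Finset (Fin n) × Finset (Fin n),
      p.1.Nonempty ∧ p.2.Nonempty ∧
      max (p.1.card : ℝ) p.2.card ≤ q ^ 7 * √(p.1.card * p.2.card) ∧
      q ^ 14 * √(p.1.card * p.2.card) ≤
        |cut (lowerPart (A ω) (meanMatrix n n₁ (q ^ 20) r)) p.1 p.2|} ≤ (4 * n : ℝ)⁻¹ := by
  have hq0 : 0 < q := by linarith
  have hn0 : (0:ℝ) < n := by positivity
  refine (measureReal_exists_le _).trans ?_
  set f : Finset (Fin n) → ℝ := fun S => if S.Nonempty then exp (-4 * ent n S.card) else 0 with hf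
  have hf0 : ∀ S, 0 ≤ f S := fun S => by simp only [hf]; split_ifs <;> positivity
  have key : ∀ p : Finset (Fin n) × Finset (Fin n), μ.real {ω | p.1.Nonempty ∧ p.2.Nonempty ∧
      max (p.1.card : ℝ) p.2.card ≤ q ^ 7 * √(p.1.card * p.2.card) ∧
      q ^ 14 * √(p.1.card * p.2.card) ≤
        |cut (lowerPart (A ω) (meanMatrix n n₁ (q ^ 20) r)) p.1 p.2|} ≤ 2 * (f p.1 * f p.2) := by
    intro p
    by_cases h : p.1.Nonempty ∧ p.2.Nonempty ∧
      max (p.1.card : ℝ) p.2.card ≤ q ^ 7 * √(p.1.card * p.2.card)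
    · obtain ⟨h1, h2, h3⟩ := h
      have c1 : (p.1.card : ℝ) ≤ n := by exact_mod_cast (Finset.card_le_univ _).trans_eq (by simp)
      have c2 : (p.2.card : ℝ) ≤ n := by exact_mod_cast (Finset.card_le_univ _).trans_eq (by simp)
      have d1 : (1:ℝ) ≤ p.1.card := by exact_mod_cast h1.card_pos
      have d2 : (1:ℝ) ≤ p.2.card := by exact_mod_cast h2.card_pos
      obtain ⟨θ, hθ, hb⟩ := exists_chernoff_parameter hq2 hq d1 d2 c1 c2 h3
      have hpr := prob_cut_ge (by positivity) hr₀ hr₁ hA p.1 p.2 hθ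
        (q ^ 14 * √(p.1.card * p.2.card))
      refine (measureReal_mono fun ω hω => hω.2.2.2).trans (hpr.trans ?_)
      simp only [hf, h1, h2, if_true]
      rw [← exp_add]
      -- The 8 splits as 4 + 4: the entropy of the larger set bounds that of each of the two, so the
      -- union bound factors over `S` and `T`.
      refine mul_le_mul_of_nonneg_left (exp_le_exp.2 (hb.trans ?_)) zero_le_two
      have e1 := ent_mono (n := n) (by linarith) (le_max_left (p.1.card : ℝ) p.2.card) (max_le c1 c2)
      have e2 := ent_mono (n := n) (by linarith) (le_max_right (p.1.card : ℝ) p.2.card) (max_le c1 c2)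
      linarith
    · have : {ω | p.1.Nonempty ∧ p.2.Nonempty ∧
          max (p.1.card : ℝ) p.2.card ≤ q ^ 7 * √(p.1.card * p.2.card) ∧
          q ^ 14 * √(p.1.card * p.2.card) ≤
          |cut (lowerPart (A ω) (meanMatrix n n₁ (q ^ 20) r)) p.1 p.2|} = ∅ := by
        ext ω
        simp only [Set.mem_ofPred_eq, Set.mem_empty_iff_false, iff_false]
        tauto
      rw [this, measureReal_empty]
      have := mul_nonneg (hf0 p.1) (hf0 p.2)
      linarith
  refine (Finset.sum_le_sum fun p _ => key p).trans ?_
  rw [← Finset.mul_sum, Fintype.sum_prod_type, ← Finset.sum_mul_sum]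
  have hs : ∑ S, f S ≤ (n:ℝ)⁻¹ := sum_exp_neg_ent_le (by lia)
  have hs0 : 0 ≤ ∑ S, f S := Finset.sum_nonneg fun S _ => hf0 S
  have : (8:ℝ) ≤ n := by exact_mod_cast hn
  calc _ ≤ 2 * ((n:ℝ)⁻¹ * (n:ℝ)⁻¹) := by gcongr
    _ ≤ 2 * ((8:ℝ)⁻¹ * (n:ℝ)⁻¹) := by gcongr
    _ = _ := by field_simp; norm_num

theorem abs_sub_le_of_zero_or_one {a p : ℝ} (h : a = 0 ∨ a = 1) (hp : 0 ≤ p) :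
    |a - p| ≤ (a - p) + 2 * p := by
  rw [abs_le]
  rcases h with rfl | rfl <;> constructor <;> linarith

/-- Absolute line sums follow from signed ones because `|a - p| ≤ (a - p) + 2p` for a 0-1 entry. For
an unbalanced pair, row or column sums alone give `min s t * q ^ 21`, and the imbalance says exactly
that `min s t * q ^ 7 ≤ √(s * t)`. -/
theorem isRegular_of_bounds {B : Matrix (Fin n) (Fin n) ℝ} (hB : ∀ i j, B i j = 0 ∨ B i j = 1)
    (hq : 4 ≤ q) (hr₀ : 0 ≤ r) (hr₁ : r ≤ 1) (hn : 0 < n)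
    (hcut : ∀ S T, |cut (lowerPart B (meanMatrix n n₁ (q ^ 20) r)) S T| ≤ 4 * n * q ^ 10)
    (hrow : ∀ i, |cut (lowerPart B (meanMatrix n n₁ (q ^ 20) r)) {i} Finset.univ| ≤ q ^ 21 / 2)
    (hcol : ∀ j, |cut (lowerPart B (meanMatrix n n₁ (q ^ 20) r)) Finset.univ {j}| ≤ q ^ 21 / 2)
    (hdisc : ∀ S T : Finset (Fin n), S.Nonempty → T.Nonempty →
      max (S.card : ℝ) T.card ≤ q ^ 7 * √(S.card * T.card) →
      |cut (lowerPart B (meanMatrix n n₁ (q ^ 20) r)) S T| ≤ q ^ 14 * √(S.card * T.card)) :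
    IsRegular q (lowerPart B (meanMatrix n n₁ (q ^ 20) r)) := by
  have hq0 : 0 < q := by linarith
  have hn0 : (0:ℝ) < n := by exact_mod_cast hn
  set L := lowerPart B (meanMatrix n n₁ (q ^ 20) r) with hL
  have hLe : ∀ i j, |L i j| ≤ L i j + 2 * (q ^ 20 / n) := by
    intro i j
    simp only [hL, lowerPart, Matrix.of_apply]
    split_ifs with h
    · have h1 := meanMatrix_nonneg (n := n) (n₁ := n₁) (lam := q ^ 20) (by positivity) hr₀ i j
      have h2 := meanMatrix_le (n := n) (n₁ := n₁) (lam := q ^ 20) (by positivity) hr₁ i j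
      linarith [abs_sub_le_of_zero_or_one (hB i j) h1]
    · simp only [abs_zero, zero_add]; positivity
  have h21 : 4 * q ^ 20 ≤ q ^ 21 := by
    rw [show q ^ 21 = q * q ^ 20 by ring]
    gcongr
  have hrow' : ∀ i, ∑ j, |L i j| ≤ q ^ 21 := by
    intro i
    have h1 := (le_abs_self _).trans (hrow i)
    simp only [cut, Finset.sum_singleton] at h1
    calc ∑ j, |L i j| ≤ ∑ j, (L i j + 2 * (q ^ 20 / n)) := Finset.sum_le_sum fun j _ => hLe i j
      _ = ∑ j, L i j + 2 * q ^ 20 := by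
          rw [Finset.sum_add_distrib, Finset.sum_const, Finset.card_univ, Fintype.card_fin,
            nsmul_eq_mul]
          field_simp
      _ ≤ _ := by linarith
  have hcol' : ∀ j, ∑ i, |L i j| ≤ q ^ 21 := by
    intro j
    have h1 := (le_abs_self _).trans (hcol j)
    simp only [cut, Finset.sum_singleton] at h1
    calc ∑ i, |L i j| ≤ ∑ i, (L i j + 2 * (q ^ 20 / n)) := Finset.sum_le_sum fun i _ => hLe i j
      _ = ∑ i, L i j + 2 * q ^ 20 := by
          rw [Finset.sum_add_distrib, Finset.sum_const, Finset.card_univ, Fintype.card_fin,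
            nsmul_eq_mul]
          field_simp
      _ ≤ _ := by linarith
  refine ⟨hcut, hrow', hcol', fun S T => ?_⟩
  rcases S.eq_empty_or_nonempty with rfl | hS
  · simp [cut]
  rcases T.eq_empty_or_nonempty with rfl | hT
  · simp [cut]
  by_cases hbal : max (S.card : ℝ) T.card ≤ q ^ 7 * √(S.card * T.card)
  · exact hdisc S T hS hT hbal
  push Not at hbal
  have hsub : |cut L S T| ≤ ∑ i ∈ S, ∑ j ∈ T, |L i j| :=
    (Finset.abs_sum_le_sum_abs _ _).trans
      (Finset.sum_le_sum fun i _ => Finset.abs_sum_le_sum_abs _ _)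
  have hS' : ∑ i ∈ S, ∑ j ∈ T, |L i j| ≤ S.card * q ^ 21 := by
    rw [← nsmul_eq_mul, ← Finset.sum_const]
    exact Finset.sum_le_sum fun i _ => (Finset.sum_le_sum_of_subset_of_nonneg
      (Finset.subset_univ T) fun _ _ _ => abs_nonneg _).trans (hrow' i)
  have hT' : ∑ i ∈ S, ∑ j ∈ T, |L i j| ≤ T.card * q ^ 21 := by
    rw [← nsmul_eq_mul, ← Finset.sum_const, Finset.sum_comm]
    exact Finset.sum_le_sum fun i _ => (Finset.sum_le_sum_of_subset_of_nonneg
      (Finset.subset_univ S) fun _ _ _ => abs_nonneg _).trans (hcol' i)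
  set s : ℝ := (S.card : ℝ)
  set t : ℝ := (T.card : ℝ)
  have hs0 : 0 < s := by simpa [s] using hS.card_pos
  have ht0 : 0 < t := by simpa [t] using hT.card_pos
  have hmin : min s t * q ^ 7 ≤ √(s * t) := by
    have h1 : min s t * max s t = √(s * t) * √(s * t) := by
      rw [min_mul_max, mul_self_sqrt (by positivity)]
    have h2 : 0 < √(s * t) := by positivity
    have h3 : min s t * (q ^ 7 * √(s * t)) ≤ √(s * t) * √(s * t) := by
      rw [← h1]
      have : 0 ≤ min s t := by positivity
      gcongr
    nlinarith
  have hfin : ∑ i ∈ S, ∑ j ∈ T, |L i j| ≤ min s t * q ^ 21 := by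
    rcases min_choice s t with h | h <;> rw [h] <;> assumption
  calc |cut L S T| ≤ min s t * q ^ 21 := hsub.trans hfin
    _ = q ^ 14 * (min s t * q ^ 7) := by ring
    _ ≤ _ := by gcongr

theorem prob_not_isRegular_le (hq4 : 4 ≤ q) (hq : 32 * (1 + 20 * log q) ≤ q)
    (hr₀ : 0 ≤ r) (hr₁ : r ≤ 1) (hn : 8 ≤ n) (hlog : 16 * log n ≤ q ^ 21)
    (hA : IsSBM μ (blockProb n (q ^ 20) r r) (community n n₁) A) :
    μ.real {ω | ¬ IsRegular q (lowerPart (A ω) (meanMatrix n n₁ (q ^ 20) r))} ≤ (n:ℝ)⁻¹ := by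
  have b1 := prob_cut_gt (by linarith) hr₀ hr₁ (by lia) hA
  have b2 := prob_line_gt hq4 hr₀ hr₁ (by lia) hlog hA (fun i => {i}) (fun _ => Finset.univ)
    (by simp)
  have b3 := prob_line_gt hq4 hr₀ hr₁ (by lia) hlog hA (fun _ => Finset.univ) (fun i => {i})
    (by simp)
  have b4 := prob_disc_gt (by linarith) hq hr₀ hr₁ hn hA
  set E1 := {ω | ∃ p : Finset (Fin n) × Finset (Fin n),
      4 * n * q ^ 10 ≤ |cut (lowerPart (A ω) (meanMatrix n n₁ (q ^ 20) r)) p.1 p.2|}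
  set E2 := {ω | ∃ i, q ^ 21 / 2 ≤
      |cut (lowerPart (A ω) (meanMatrix n n₁ (q ^ 20) r)) {i} Finset.univ|}
  set E3 := {ω | ∃ i, q ^ 21 / 2 ≤
      |cut (lowerPart (A ω) (meanMatrix n n₁ (q ^ 20) r)) Finset.univ {i}|}
  set E4 := {ω | ∃ p : Finset (Fin n) × Finset (Fin n),
      p.1.Nonempty ∧ p.2.Nonempty ∧
      max (p.1.card : ℝ) p.2.card ≤ q ^ 7 * √(p.1.card * p.2.card) ∧
      q ^ 14 * √(p.1.card * p.2.card) ≤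
        |cut (lowerPart (A ω) (meanMatrix n n₁ (q ^ 20) r)) p.1 p.2|}
  have hsub : {ω | ¬ IsRegular q (lowerPart (A ω) (meanMatrix n n₁ (q ^ 20) r))}
      ⊆ (E1 ∪ E2) ∪ (E3 ∪ E4) := by
    intro ω hω
    by_contra hcon
    simp only [Set.mem_union, not_or] at hcon
    obtain ⟨⟨h1, h2⟩, h3, h4⟩ := hcon
    refine hω (isRegular_of_bounds (hA.zero_or_one ω) hq4 hr₀ hr₁ (by lia) ?_ ?_ ?_ ?_)
    · intro S T
      by_contra hc
      exact h1 ⟨(S, T), (not_le.1 hc).le⟩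
    · intro i
      by_contra hc
      exact h2 ⟨i, (not_le.1 hc).le⟩
    · intro i
      by_contra hc
      exact h3 ⟨i, (not_le.1 hc).le⟩
    · intro S T hS hT hb
      by_contra hc
      exact h4 ⟨(S, T), hS, hT, hb, (not_le.1 hc).le⟩
  have u1 := (measureReal_mono hsub).trans (measureReal_union_le (μ := μ) _ _)
  have u2 := measureReal_union_le (μ := μ) E1 E2
  have u3 := measureReal_union_le (μ := μ) E3 E4
  have e : (4 * (n:ℝ))⁻¹ + (8 * (n:ℝ))⁻¹ + ((8 * (n:ℝ))⁻¹ + (4 * (n:ℝ))⁻¹) ≤ (n:ℝ)⁻¹ := by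
    rw [mul_inv, mul_inv]
    have : 0 ≤ (n:ℝ)⁻¹ := by positivity
    linarith
  linarith

end Union

/-! ### From discrepancy to the spectral norm -/

/-- A linear form on a box is largest at a vertex. Used once in each variable, this passes from cuts
to bilinear forms with bounded weights. -/
theorem exists_subset_sum_mul_le {ι : Type*} (S : Finset ι) (x c : ι → ℝ) {a : ℝ}
    (hx : ∀ i ∈ S, 0 ≤ x i ∧ x i ≤ a) : ∃ S' ⊆ S, ∑ i ∈ S, x i * c i ≤ a * ∑ i ∈ S', c i := by
  classical
  refine ⟨S.filter (fun i => 0 ≤ c i), Finset.filter_subset _ _, ?_⟩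
  rw [Finset.sum_filter, Finset.mul_sum]
  refine Finset.sum_le_sum fun i hi => ?_
  obtain ⟨h0, h1⟩ := hx i hi
  split_ifs with h
  · gcongr
  · rw [mul_zero]
    exact mul_nonpos_of_nonneg_of_nonpos h0 (not_le.1 h).le

theorem bilin_box_le {n : ℕ} (L : Matrix (Fin n) (Fin n) ℝ) (S T : Finset (Fin n))
    (x y : Fin n → ℝ) {a b B : ℝ} (ha : 0 ≤ a) (hb : 0 ≤ b)
    (hx : ∀ i ∈ S, 0 ≤ x i ∧ x i ≤ a) (hy : ∀ i ∈ T, 0 ≤ y i ∧ y i ≤ b)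
    (hB : ∀ S' ⊆ S, ∀ T' ⊆ T, cut L S' T' ≤ B) :
    ∑ i ∈ S, ∑ j ∈ T, x i * L i j * y j ≤ a * b * B := by
  obtain ⟨S', hS', h1⟩ := exists_subset_sum_mul_le S x (fun i => ∑ j ∈ T, L i j * y j) hx
  obtain ⟨T', hT', h2⟩ := exists_subset_sum_mul_le T y (fun j => ∑ i ∈ S', L i j) hy
  calc ∑ i ∈ S, ∑ j ∈ T, x i * L i j * y j = ∑ i ∈ S, x i * ∑ j ∈ T, L i j * y j := by
        refine Finset.sum_congr rfl fun i _ => ?_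
        rw [Finset.mul_sum]
        exact Finset.sum_congr rfl fun j _ => by ring
    _ ≤ a * ∑ i ∈ S', ∑ j ∈ T, L i j * y j := h1
    _ = a * ∑ j ∈ T, y j * ∑ i ∈ S', L i j := by
        rw [Finset.sum_comm]
        congr 1
        refine Finset.sum_congr rfl fun j _ => ?_
        rw [Finset.mul_sum]
        exact Finset.sum_congr rfl fun i _ => by ring
    _ ≤ a * (b * ∑ j ∈ T', ∑ i ∈ S', L i j) := by gcongr
    _ = a * b * cut L S' T' := by rw [Finset.sum_comm, cut]; ring
    _ ≤ _ := by gcongr; exact hB S' hS' T' hT'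

theorem abs_bilin_box_le {n : ℕ} (L : Matrix (Fin n) (Fin n) ℝ) (S T : Finset (Fin n))
    (x y : Fin n → ℝ) {a b B : ℝ} (ha : 0 ≤ a) (hb : 0 ≤ b)
    (hx : ∀ i ∈ S, 0 ≤ x i ∧ x i ≤ a) (hy : ∀ i ∈ T, 0 ≤ y i ∧ y i ≤ b)
    (hB : ∀ S' ⊆ S, ∀ T' ⊆ T, |cut L S' T'| ≤ B) :
    |∑ i ∈ S, ∑ j ∈ T, x i * L i j * y j| ≤ a * b * B := by
  rw [abs_le']
  constructor
  · exact bilin_box_le L S T x y ha hb hx hy fun S' h T' h' => (le_abs_self _).trans (hB S' h T' h')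
  · have := bilin_box_le (-L) S T x y ha hb hx hy (B := B) fun S' h T' h' => by
      refine le_trans (le_of_eq ?_) ((neg_le_abs _).trans (hB S' h T' h'))
      simp [cut]
    simpa using this

/-- The binary order of magnitude of a positive real. -/
noncomputable def level (a : ℝ) : ℤ := Int.log 2 a

theorem zpow_level_le {a : ℝ} (ha : 0 < a) : (2:ℝ) ^ level a ≤ a := by
  exact_mod_cast Int.zpow_log_le_self (b := 2) one_lt_two ha

theorem lt_zpow_level (a : ℝ) : a < (2:ℝ) ^ (level a + 1) := by
  exact_mod_cast Int.lt_zpow_succ_log_self (b := 2) one_lt_two a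

/-- The strict inequality between levels pays for the factor 2 in `b < 2 ^ (level b + 1)`. -/
theorem mul_le_sq_of_level_lt {a b : ℝ} {g : ℕ} (ha : 0 < a) (h : level b + g < level a) :
    a * b ≤ ((2:ℝ) ^ g)⁻¹ * a ^ 2 := by
  have h1 : b ≤ ((2:ℝ) ^ g)⁻¹ * a := by
    calc b ≤ (2:ℝ) ^ (level b + 1) := (lt_zpow_level b).le
      _ ≤ (2:ℝ) ^ (level a - g) := zpow_le_zpow_right₀ one_le_two (by lia)
      _ = ((2:ℝ) ^ g)⁻¹ * (2:ℝ) ^ level a := by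
          rw [zpow_sub₀ two_ne_zero, zpow_natCast]; field_simp
      _ ≤ _ := by gcongr; exact zpow_level_le ha
  calc a * b ≤ a * (((2:ℝ) ^ g)⁻¹ * a) := by gcongr
    _ = _ := by ring

theorem card_filter_near_le (K : Finset ℤ) (k : ℤ) (g : ℕ) :
    ((K.filter fun l => |k - l| ≤ g).card : ℝ) ≤ 2 * g + 1 := by
  have : (K.filter fun l => |k - l| ≤ g) ⊆ Finset.Icc (k - g) (k + g) := by
    intro l hl
    rw [Finset.mem_filter, abs_le] at hl
    rw [Finset.mem_Icc]
    lia
  have h := Finset.card_le_card this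
  rw [Int.card_Icc] at h
  have h' : (K.filter fun l => |k - l| ≤ g).card ≤ 2 * g + 1 := by lia
  exact_mod_cast h'

theorem sum_near_le (K K' : Finset ℤ) (u : ℤ → ℝ) (hu : ∀ k, 0 ≤ u k) (g : ℕ) :
    ∑ k ∈ K, ∑ l ∈ K', (if |k - l| ≤ g then u k else 0) ≤ (2 * g + 1) * ∑ k ∈ K, u k := by
  rw [Finset.mul_sum]
  refine Finset.sum_le_sum fun k _ => ?_
  rw [← Finset.sum_filter, Finset.sum_const, nsmul_eq_mul]
  exact mul_le_mul_of_nonneg_right (card_filter_near_le K' k g) (hu k)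

section Discrepancy

variable {n : ℕ} {L : Matrix (Fin n) (Fin n) ℝ} {α d : ℝ}

/-- On such a block x and y are constant up to a factor 2, so the form is at most 4α · (2^k
√|X|)(2^l √|Y|); the inequality between the two means then gives sums of squares, which add up over
blocks. -/
theorem abs_level_block_le (hα : 0 ≤ α) (hdisc : ∀ S T, |cut L S T| ≤ α * √(S.card * T.card))
    (X Y : Finset (Fin n)) (x y : Fin n → ℝ) {k l : ℤ}
    (hx : ∀ i ∈ X, 0 < x i ∧ level (x i) = k) (hy : ∀ i ∈ Y, 0 < y i ∧ level (y i) = l) :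
    |∑ i ∈ X, ∑ j ∈ Y, x i * L i j * y j| ≤
      2 * α * (∑ i ∈ X, x i ^ 2 + ∑ j ∈ Y, y j ^ 2) := by
  have hup : ∀ (Z : Finset (Fin n)) (z : Fin n → ℝ) (m : ℤ),
      (∀ i ∈ Z, 0 < z i ∧ level (z i) = m) →
      (∀ i ∈ Z, 0 ≤ z i ∧ z i ≤ 2 * (2:ℝ) ^ m) ∧
      ((2:ℝ) ^ m * √Z.card) ^ 2 ≤ ∑ i ∈ Z, z i ^ 2 := by
    intro Z z m h
    constructor
    · intro i hi
      obtain ⟨h0, h1⟩ := h i hi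
      have := lt_zpow_level (z i)
      rw [h1, zpow_add_one₀ two_ne_zero] at this
      exact ⟨h0.le, by linarith⟩
    · rw [mul_pow, sq_sqrt (Nat.cast_nonneg _), mul_comm, ← nsmul_eq_mul, ← Finset.sum_const]
      refine Finset.sum_le_sum fun i hi => ?_
      obtain ⟨h0, h1⟩ := h i hi
      have := zpow_level_le h0
      rw [h1] at this
      gcongr
  obtain ⟨hx1, hx2⟩ := hup X x k hx
  obtain ⟨hy1, hy2⟩ := hup Y y l hy
  have hbox := abs_bilin_box_le L X Y x y (a := 2 * (2:ℝ) ^ k) (b := 2 * (2:ℝ) ^ l)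
    (B := α * √(X.card * Y.card)) (by positivity) (by positivity) hx1 hy1
    (fun S' hS T' hT => (hdisc S' T').trans (by
      have h1 : (S'.card : ℝ) ≤ X.card := by exact_mod_cast Finset.card_le_card hS
      have h2 : (T'.card : ℝ) ≤ Y.card := by exact_mod_cast Finset.card_le_card hT
      gcongr))
  refine hbox.trans ?_
  rw [sqrt_mul (Nat.cast_nonneg _)]
  set p := (2:ℝ) ^ k * √X.card
  set s := (2:ℝ) ^ l * √Y.card
  calc _ = 2 * α * (2 * p * s) := by simp only [p, s]; ring
    _ ≤ 2 * α * (p ^ 2 + s ^ 2) := by gcongr; exact two_mul_le_add_sq p s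
    _ ≤ _ := by gcongr

/-- A matrix of small discrepancy and bounded row and column sums is small as a bilinear form on
nonnegative vectors. -/
theorem abs_bilin_le_of_nonneg (hα : 0 ≤ α) (hdisc : ∀ S T, |cut L S T| ≤ α * √(S.card * T.card))
    (hrow : ∀ i, ∑ j, |L i j| ≤ d) (hcol : ∀ j, ∑ i, |L i j| ≤ d) (g : ℕ)
    {x y : Fin n → ℝ} (hx : ∀ i, 0 ≤ x i) (hy : ∀ i, 0 ≤ y i) :
    |∑ i, ∑ j, x i * L i j * y j| ≤
      (2 * α * (2 * g + 1) + d / 2 ^ g) * (∑ i, x i ^ 2 + ∑ j, y j ^ 2) := by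
  classical
  set X := Finset.univ.filter fun i => 0 < x i with hX
  set Y := Finset.univ.filter fun i => 0 < y i with hY
  have hxX : ∀ i, i ∉ X → x i = 0 := fun i hi => by
    simp only [hX, Finset.mem_filter, Finset.mem_univ, true_and, not_lt] at hi
    exact le_antisymm hi (hx i)
  have hyY : ∀ i, i ∉ Y → y i = 0 := fun i hi => by
    simp only [hY, Finset.mem_filter, Finset.mem_univ, true_and, not_lt] at hi
    exact le_antisymm hi (hy i)
  have hX0 : ∀ i ∈ X, 0 < x i := fun i hi => (Finset.mem_filter.1 hi).2
  have hY0 : ∀ i ∈ Y, 0 < y i := fun i hi => (Finset.mem_filter.1 hi).2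
  have hred : ∑ i, ∑ j, x i * L i j * y j = ∑ i ∈ X, ∑ j ∈ Y, x i * L i j * y j := by
    rw [← Finset.sum_subset (Finset.subset_univ X)
      (fun i _ hi => by simp [hxX i hi])]
    refine Finset.sum_congr rfl fun i _ => ?_
    rw [← Finset.sum_subset (Finset.subset_univ Y) (fun i _ hi => by simp [hyY i hi])]
  -- Entries of comparable size are handled blockwise by discrepancy, each level meeting at most 2g
  -- + 1 others. For the remaining pairs `x i * y j` is at most 2^(-g) times the larger square, and
  -- row and column sums suffice.
  set near : Fin n → Fin n → Prop := fun i j => |level (x i) - level (y j)| ≤ g with hnear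
  have hsplit : ∑ i ∈ X, ∑ j ∈ Y, x i * L i j * y j
      = ∑ i ∈ X, ∑ j ∈ Y, (if near i j then x i * L i j * y j else 0)
        + ∑ i ∈ X, ∑ j ∈ Y, (if near i j then 0 else x i * L i j * y j) := by
    simp_rw [← Finset.sum_add_distrib]
    refine Finset.sum_congr rfl fun i _ => Finset.sum_congr rfl fun j _ => ?_
    split_ifs <;> simp
  have hfar : |∑ i ∈ X, ∑ j ∈ Y, (if near i j then 0 else x i * L i j * y j)|
      ≤ d / 2 ^ g * (∑ i, x i ^ 2 + ∑ j, y j ^ 2) := by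
    have hterm : ∀ i ∈ X, ∀ j ∈ Y, |if near i j then 0 else x i * L i j * y j|
        ≤ ((2:ℝ) ^ g)⁻¹ * (x i ^ 2 * |L i j|) + ((2:ℝ) ^ g)⁻¹ * (y j ^ 2 * |L i j|) := by
      intro i hi j hj
      split_ifs with h
      · rw [abs_zero]; positivity
      · have hxi := hX0 i hi
        have hyj := hY0 j hj
        have e : |x i * L i j * y j| = x i * y j * |L i j| := by
          rw [abs_mul, abs_mul, abs_of_pos hxi, abs_of_pos hyj]; ring
        have hxy : x i * y j ≤ ((2:ℝ) ^ g)⁻¹ * x i ^ 2 + ((2:ℝ) ^ g)⁻¹ * y j ^ 2 := by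
          have p1 : 0 ≤ ((2:ℝ) ^ g)⁻¹ * x i ^ 2 := by positivity
          have p2 : 0 ≤ ((2:ℝ) ^ g)⁻¹ * y j ^ 2 := by positivity
          simp only [hnear, not_le, lt_abs] at h
          rcases h with h | h
          · have := mul_le_sq_of_level_lt (b := y j) (g := g) hxi (by lia)
            linarith
          · have := mul_le_sq_of_level_lt (b := x i) (g := g) hyj (by lia)
            linarith [mul_comm (x i) (y j)]
        rw [e]
        calc _ ≤ (((2:ℝ) ^ g)⁻¹ * x i ^ 2 + ((2:ℝ) ^ g)⁻¹ * y j ^ 2) * |L i j| := by gcongr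
          _ = _ := by ring
    calc _ ≤ ∑ i ∈ X, ∑ j ∈ Y, |if near i j then 0 else x i * L i j * y j| :=
          (Finset.abs_sum_le_sum_abs _ _).trans
            (Finset.sum_le_sum fun i _ => Finset.abs_sum_le_sum_abs _ _)
      _ ≤ ∑ i ∈ X, ∑ j ∈ Y,
          (((2:ℝ) ^ g)⁻¹ * (x i ^ 2 * |L i j|) + ((2:ℝ) ^ g)⁻¹ * (y j ^ 2 * |L i j|)) :=
          Finset.sum_le_sum fun i hi => Finset.sum_le_sum fun j hj => hterm i hi j hj
      _ ≤ ∑ i, ∑ j,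
          (((2:ℝ) ^ g)⁻¹ * (x i ^ 2 * |L i j|) + ((2:ℝ) ^ g)⁻¹ * (y j ^ 2 * |L i j|)) := by
          refine (Finset.sum_le_sum fun i _ => Finset.sum_le_sum_of_subset_of_nonneg
            (Finset.subset_univ Y) fun j _ _ => by positivity).trans ?_
          exact Finset.sum_le_sum_of_subset_of_nonneg (Finset.subset_univ X)
            fun i _ _ => Finset.sum_nonneg fun j _ => by positivity
      _ = ((2:ℝ) ^ g)⁻¹ * ∑ i, x i ^ 2 * ∑ j, |L i j|
          + ((2:ℝ) ^ g)⁻¹ * ∑ j, y j ^ 2 * ∑ i, |L i j| := by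
          simp_rw [Finset.sum_add_distrib, Finset.mul_sum]
          congr 1
          rw [Finset.sum_comm]
      _ ≤ ((2:ℝ) ^ g)⁻¹ * ∑ i, x i ^ 2 * d + ((2:ℝ) ^ g)⁻¹ * ∑ j, y j ^ 2 * d := by
          gcongr with i _ j _
          · exact hrow i
          · exact hcol j
      _ = _ := by rw [← Finset.sum_mul, ← Finset.sum_mul]; ring
  have hnr : |∑ i ∈ X, ∑ j ∈ Y, (if near i j then x i * L i j * y j else 0)|
      ≤ 2 * α * (2 * g + 1) * (∑ i, x i ^ 2 + ∑ j, y j ^ 2) := by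
    set K := X.image fun i => level (x i)
    set K' := Y.image fun i => level (y i)
    have hK : ∀ f : Fin n → ℝ, ∑ i ∈ X, f i = ∑ k ∈ K, ∑ i ∈ X with level (x i) = k, f i :=
      fun f => (Finset.sum_fiberwise_of_maps_to (fun i hi => Finset.mem_image_of_mem _ hi) _).symm
    have hK' : ∀ f : Fin n → ℝ, ∑ i ∈ Y, f i = ∑ k ∈ K', ∑ i ∈ Y with level (y i) = k, f i :=
      fun f => (Finset.sum_fiberwise_of_maps_to (fun i hi => Finset.mem_image_of_mem _ hi) _).symm
    set u : ℤ → ℝ := fun k => ∑ i ∈ X with level (x i) = k, x i ^ 2 with hu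
    set v : ℤ → ℝ := fun k => ∑ i ∈ Y with level (y i) = k, y i ^ 2 with hv
    have hu0 : ∀ k, 0 ≤ u k := fun k => Finset.sum_nonneg fun i _ => by positivity
    have hv0 : ∀ k, 0 ≤ v k := fun k => Finset.sum_nonneg fun i _ => by positivity
    have e1 : ∑ i ∈ X, ∑ j ∈ Y, (if near i j then x i * L i j * y j else 0)
        = ∑ k ∈ K, ∑ l ∈ K', (if |k - l| ≤ g then
          ∑ i ∈ X with level (x i) = k, ∑ j ∈ Y with level (y j) = l, x i * L i j * y j else 0) := by
      rw [hK]
      refine Finset.sum_congr rfl fun k _ => ?_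
      simp_rw [hK' _]
      rw [Finset.sum_comm]
      refine Finset.sum_congr rfl fun l _ => ?_
      split_ifs with h
      · refine Finset.sum_congr rfl fun i hi => Finset.sum_congr rfl fun j hj => ?_
        rw [if_pos]
        simp only [hnear, (Finset.mem_filter.1 hi).2, (Finset.mem_filter.1 hj).2, h]
      · refine Finset.sum_eq_zero fun i hi => Finset.sum_eq_zero fun j hj => ?_
        rw [if_neg]
        simp only [hnear, (Finset.mem_filter.1 hi).2, (Finset.mem_filter.1 hj).2, h,
          not_false_eq_true]
    have e2 : ∑ k ∈ K, u k ≤ ∑ i, x i ^ 2 := by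
      rw [hu, ← hK]
      exact Finset.sum_le_sum_of_subset_of_nonneg (Finset.subset_univ X) fun _ _ _ => by positivity
    have e3 : ∑ k ∈ K', v k ≤ ∑ i, y i ^ 2 := by
      rw [hv, ← hK']
      exact Finset.sum_le_sum_of_subset_of_nonneg (Finset.subset_univ Y) fun _ _ _ => by positivity
    have e4 : ∑ k ∈ K, ∑ l ∈ K', (if |k - l| ≤ g then v l else 0) ≤ (2 * g + 1) * ∑ l ∈ K', v l := by
      rw [Finset.sum_comm]
      simp_rw [abs_sub_comm]
      exact sum_near_le K' K v hv0 g
    rw [e1]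
    calc _ ≤ ∑ k ∈ K, ∑ l ∈ K', (2 * α * ((if |k - l| ≤ g then u k else 0)
          + (if |k - l| ≤ g then v l else 0))) := by
          refine (Finset.abs_sum_le_sum_abs _ _).trans (Finset.sum_le_sum fun k _ =>
            (Finset.abs_sum_le_sum_abs _ _).trans (Finset.sum_le_sum fun l _ => ?_))
          split_ifs with h
          · refine abs_level_block_le hα hdisc _ _ x y (k := k) (l := l) ?_ ?_
            · intro i hi
              rw [Finset.mem_filter] at hi
              exact ⟨hX0 i hi.1, hi.2⟩
            · intro i hi
              rw [Finset.mem_filter] at hi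
              exact ⟨hY0 i hi.1, hi.2⟩
          · simp
      _ = 2 * α * (∑ k ∈ K, ∑ l ∈ K', (if |k - l| ≤ g then u k else 0)
          + ∑ k ∈ K, ∑ l ∈ K', (if |k - l| ≤ g then v l else 0)) := by
          simp_rw [← Finset.mul_sum, Finset.sum_add_distrib]
      _ ≤ 2 * α * ((2 * g + 1) * ∑ i, x i ^ 2 + (2 * g + 1) * ∑ j, y j ^ 2) := by
          gcongr
          · exact (sum_near_le K K' u hu0 g).trans (by gcongr)
          · exact e4.trans (by gcongr)
      _ = _ := by ring
  rw [hred, hsplit]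
  refine (abs_add_le _ _).trans ?_
  rw [add_mul]
  exact add_le_add hnr hfar

/-- Split into positive and negative parts: squares add without cross terms, and each part occurs in
two of the four forms, whence the factor 2. -/
theorem abs_bilin_le (hα : 0 ≤ α) (hdisc : ∀ S T, |cut L S T| ≤ α * √(S.card * T.card))
    (hrow : ∀ i, ∑ j, |L i j| ≤ d) (hcol : ∀ j, ∑ i, |L i j| ≤ d) (g : ℕ) (x y : Fin n → ℝ) :
    |∑ i, ∑ j, x i * L i j * y j| ≤
      2 * (2 * α * (2 * g + 1) + d / 2 ^ g) * (∑ i, x i ^ 2 + ∑ j, y j ^ 2) := by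
  have hb := fun {x y : Fin n → ℝ} => abs_bilin_le_of_nonneg (x := x) (y := y) hα hdisc hrow hcol g
  set b := 2 * α * (2 * g + 1) + d / 2 ^ g
  set xp : Fin n → ℝ := fun i => max (x i) 0
  set xm : Fin n → ℝ := fun i => max (-x i) 0
  set yp : Fin n → ℝ := fun i => max (y i) 0
  set ym : Fin n → ℝ := fun i => max (-y i) 0
  have hsub : ∀ a : ℝ, a = max a 0 - max (-a) 0 := fun a => by
    rcases le_total a 0 with h | h
    · rw [max_eq_right h, max_eq_left (by linarith)]; ring
    · rw [max_eq_left h, max_eq_right (by linarith)]; ring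
  have hsq : ∀ a : ℝ, a ^ 2 = max a 0 ^ 2 + max (-a) 0 ^ 2 := fun a => by
    rcases le_total a 0 with h | h
    · rw [max_eq_right h, max_eq_left (by linarith)]; ring
    · rw [max_eq_left h, max_eq_right (by linarith)]; ring
  have hx2 : ∑ i, x i ^ 2 = ∑ i, xp i ^ 2 + ∑ i, xm i ^ 2 := by
    rw [← Finset.sum_add_distrib]; exact Finset.sum_congr rfl fun i _ => hsq _
  have hy2 : ∑ i, y i ^ 2 = ∑ i, yp i ^ 2 + ∑ i, ym i ^ 2 := by
    rw [← Finset.sum_add_distrib]; exact Finset.sum_congr rfl fun i _ => hsq _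
  have hexp : ∑ i, ∑ j, x i * L i j * y j = (∑ i, ∑ j, xp i * L i j * yp j
      - ∑ i, ∑ j, xp i * L i j * ym j) - (∑ i, ∑ j, xm i * L i j * yp j
      - ∑ i, ∑ j, xm i * L i j * ym j) := by
    simp_rw [← Finset.sum_sub_distrib]
    refine Finset.sum_congr rfl fun i _ => Finset.sum_congr rfl fun j _ => ?_
    rw [hsub (x i), hsub (y j)]
    simp only [xp, xm, yp, ym]
    ring
  have h1 := hb (x := xp) (y := yp) (fun _ => le_max_right _ _) (fun _ => le_max_right _ _)
  have h2 := hb (x := xp) (y := ym) (fun _ => le_max_right _ _) (fun _ => le_max_right _ _)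
  have h3 := hb (x := xm) (y := yp) (fun _ => le_max_right _ _) (fun _ => le_max_right _ _)
  have h4 := hb (x := xm) (y := ym) (fun _ => le_max_right _ _) (fun _ => le_max_right _ _)
  rw [hexp, hx2, hy2]
  refine (abs_sub _ _).trans ((add_le_add (abs_sub _ _) (abs_sub _ _)).trans ?_)
  linarith

end Discrepancy

/-! ### Spectral perturbation of a positive semidefinite matrix of rank two -/

theorem dotProduct_eq_sum_sq {n : ℕ} (x : Fin n → ℝ) : x ⬝ᵥ x = ∑ i, x i ^ 2 :=
  Finset.sum_congr rfl fun i _ => (sq (x i)).symm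

theorem dotProduct_self_nonneg' {n : ℕ} (x : Fin n → ℝ) : 0 ≤ x ⬝ᵥ x := by
  rw [dotProduct_eq_sum_sq]; positivity

theorem dotProduct_self_pos' {n : ℕ} {x : Fin n → ℝ} (hx : x ≠ 0) : 0 < x ⬝ᵥ x :=
  lt_of_le_of_ne (dotProduct_self_nonneg' x) fun h => hx (dotProduct_self_eq_zero.1 h.symm)

theorem sub_dotProduct_sub_le {n : ℕ} (x y : Fin n → ℝ) :
    (x - y) ⬝ᵥ (x - y) ≤ 2 * (x ⬝ᵥ x) + 2 * (y ⬝ᵥ y) := by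
  simp only [dotProduct_eq_sum_sq, Finset.mul_sum, ← Finset.sum_add_distrib]
  refine Finset.sum_le_sum fun i _ => ?_
  rw [Pi.sub_apply]
  nlinarith [sq_nonneg (x i + y i)]

theorem symm_dotProduct_mulVec {n : ℕ} {B : Matrix (Fin n) (Fin n) ℝ} (hB : B.IsSymm)
    (x y : Fin n → ℝ) : x ⬝ᵥ (B *ᵥ y) = (B *ᵥ x) ⬝ᵥ y := by
  rw [Matrix.dotProduct_mulVec, ← Matrix.mulVec_transpose, hB.eq]

theorem mulVec_dotProduct_self_le_of_eigenvalues {n : ℕ} {H : Matrix (Fin n) (Fin n) ℝ}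
    (hH : H.IsSymm) {b : ℝ}
    (h : ∀ (ν : ℝ) (x : Fin n → ℝ), x ≠ 0 → H *ᵥ x = ν • x → |ν| ≤ b) (x : Fin n → ℝ) :
    (H *ᵥ x) ⬝ᵥ (H *ᵥ x) ≤ b ^ 2 * (x ⬝ᵥ x) := by
  have hH' : H.IsHermitian := by
    rw [Matrix.IsHermitian, Matrix.conjTranspose_eq_transpose_of_trivial, hH.eq]
  set v := hH'.eigenvectorBasis
  have hv : ∀ i, H *ᵥ (v i).ofLp = hH'.eigenvalues i • (v i).ofLp := hH'.mulVec_eigenvectorBasis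
  have hpars : ∀ y : Fin n → ℝ, y ⬝ᵥ y = ∑ i, (y ⬝ᵥ (v i).ofLp) ^ 2 := by
    intro y
    have h1 := v.sum_sq_norm_inner_right (WithLp.toLp 2 y)
    rw [EuclideanSpace.norm_sq_eq] at h1
    simp only [norm_eq_abs, sq_abs] at h1
    rw [dotProduct_eq_sum_sq, ← h1]
    refine Finset.sum_congr rfl fun i _ => ?_
    rw [EuclideanSpace.inner_eq_star_dotProduct]
    simp
  rw [hpars (H *ᵥ x), hpars x, Finset.mul_sum]
  refine Finset.sum_le_sum fun i _ => ?_
  rw [← symm_dotProduct_mulVec hH, hv, dotProduct_smul, smul_eq_mul, mul_pow]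
  have hne : (v i).ofLp ≠ 0 := by
    intro h0
    have : v i = 0 := by ext j; exact congrFun h0 j
    have h2 := v.orthonormal.1 i
    rw [this, norm_zero] at h2
    exact zero_ne_one h2
  have := h _ _ hne (hv i)
  have h3 : hH'.eigenvalues i ^ 2 ≤ b ^ 2 := sq_le_sq' (abs_le.1 this).1 (abs_le.1 this).2
  gcongr

section Leading

variable {n : ℕ} {B P W : Matrix (Fin n) (Fin n) ℝ} {U : Matrix (Fin 2) (Fin n) ℝ} {b : ℝ}

theorem rows_orthonormal (hU : U * Uᵀ = 1) (k l : Fin 2) :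
    U k ⬝ᵥ U l = if k = l then 1 else 0 := by
  have := congrFun (congrFun hU k) l
  rw [Matrix.mul_apply', Matrix.one_apply] at this
  exact this

/-- Pythagoras for the orthogonal projection `Uᵀ * U`. -/
theorem residual_dotProduct_self_le (hU : U * Uᵀ = 1) (x : Fin n → ℝ) :
    (x - Uᵀ *ᵥ (U *ᵥ x)) ⬝ᵥ (x - Uᵀ *ᵥ (U *ᵥ x)) = x ⬝ᵥ x - (U *ᵥ x) ⬝ᵥ (U *ᵥ x) := by
  have h1 : x ⬝ᵥ (Uᵀ *ᵥ (U *ᵥ x)) = (U *ᵥ x) ⬝ᵥ (U *ᵥ x) := by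
    rw [Matrix.dotProduct_mulVec, Matrix.vecMul_transpose]
  have h2 : (Uᵀ *ᵥ (U *ᵥ x)) ⬝ᵥ (Uᵀ *ᵥ (U *ᵥ x)) = (U *ᵥ x) ⬝ᵥ (U *ᵥ x) := by
    rw [Matrix.dotProduct_mulVec, Matrix.vecMul_transpose, Matrix.mulVec_mulVec, hU,
      Matrix.one_mulVec]
  rw [sub_dotProduct, dotProduct_sub, dotProduct_sub, h2, h1,
    dotProduct_comm (Uᵀ *ᵥ (U *ᵥ x)) x, h1]
  ring

/-- Weyl's inequality for the third eigenvalue. -/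
theorem eigenvalue_le_of_orthogonal (hU : U * Uᵀ = 1) {ρ : Fin 2 → ℝ}
    (hρ : ∀ k, B *ᵥ U k = ρ k • U k) (hBPW : B = P + W)
    (hW : ∀ x, |x ⬝ᵥ (W *ᵥ x)| ≤ b * (x ⬝ᵥ x)) {p₁ p₂ : Fin n → ℝ}
    (hP : ∀ x, p₁ ⬝ᵥ x = 0 → p₂ ⬝ᵥ x = 0 → P *ᵥ x = 0)
    {x : Fin n → ℝ} {ν : ℝ} (hx : x ≠ 0) (hUx : U *ᵥ x = 0) (hBx : B *ᵥ x = ν • x)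
    (hν : ∀ k, ν ≤ ρ k) : ν ≤ b := by
  -- Two linear conditions on the span of `U 0`, `U 1`, `x` leave a nonzero y annihilated by `P`.
  -- There the form of `B` equals that of `W`, while it is at least `ν * (y ⬝ᵥ y)`.
  set N : Matrix (Fin 2) (Fin 3) ℝ :=
    !![p₁ ⬝ᵥ U 0, p₁ ⬝ᵥ U 1, p₁ ⬝ᵥ x; p₂ ⬝ᵥ U 0, p₂ ⬝ᵥ U 1, p₂ ⬝ᵥ x]
  have hker : LinearMap.ker N.mulVecLin ≠ ⊥ :=
    LinearMap.ker_ne_bot_of_finrank_lt (by simp)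
  obtain ⟨a, ha, ha0⟩ := Submodule.exists_mem_ne_zero_of_ne_bot hker
  rw [LinearMap.mem_ker, Matrix.mulVecLin_apply] at ha
  have ha1 := congrFun ha 0
  have ha2 := congrFun ha 1
  simp only [N, Matrix.mulVec, dotProduct, Fin.sum_univ_three, Pi.zero_apply] at ha1 ha2
  simp only [Fin.isValue, Matrix.of_apply, Matrix.cons_val', Matrix.cons_val_zero,
    Matrix.cons_val_one, Matrix.cons_val] at ha1 ha2
  set y := a 0 • U 0 + a 1 • U 1 + a 2 • x with hy
  have hx0 : ∀ k, U k ⬝ᵥ x = 0 := fun k => congrFun hUx k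
  have hx0' : ∀ k, x ⬝ᵥ U k = 0 := fun k => by rw [dotProduct_comm, hx0]
  have ho := rows_orthonormal hU
  have hxx := dotProduct_self_pos' hx
  have hyy : y ⬝ᵥ y = a 0 ^ 2 + a 1 ^ 2 + a 2 ^ 2 * (x ⬝ᵥ x) := by
    simp only [hy, add_dotProduct, dotProduct_add, smul_dotProduct, dotProduct_smul, ho, hx0, hx0',
      smul_eq_mul]
    simp
    ring
  have hBy : B *ᵥ y = (a 0 * ρ 0) • U 0 + (a 1 * ρ 1) • U 1 + (a 2 * ν) • x := by
    simp only [hy, Matrix.mulVec_add, Matrix.mulVec_smul, hρ, hBx, smul_smul]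
  have hyBy : y ⬝ᵥ (B *ᵥ y) = a 0 ^ 2 * ρ 0 + a 1 ^ 2 * ρ 1 + a 2 ^ 2 * ν * (x ⬝ᵥ x) := by
    rw [hBy]
    simp only [hy, add_dotProduct, dotProduct_add, smul_dotProduct, dotProduct_smul, ho, hx0, hx0',
      smul_eq_mul]
    simp
    ring
  have hPy : P *ᵥ y = 0 := by
    apply hP
    · simp only [hy, dotProduct_add, dotProduct_smul, smul_eq_mul]
      simp only [dotProduct] at ha1 ⊢
      linarith
    · simp only [hy, dotProduct_add, dotProduct_smul, smul_eq_mul]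
      simp only [dotProduct] at ha2 ⊢
      linarith
  have hyW : y ⬝ᵥ (B *ᵥ y) ≤ b * (y ⬝ᵥ y) := by
    rw [hBPW, Matrix.add_mulVec, hPy, zero_add]
    exact (le_abs_self _).trans (hW y)
  have hypos : 0 < y ⬝ᵥ y := by
    refine lt_of_le_of_ne (dotProduct_self_nonneg' y) fun h0 => ha0 ?_
    rw [hyy] at h0
    have n0 := sq_nonneg (a 0)
    have n1 := sq_nonneg (a 1)
    have n2 := mul_nonneg (sq_nonneg (a 2)) hxx.le
    have z0 : a 0 = 0 := pow_eq_zero_iff two_ne_zero |>.1 (by linarith)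
    have z1 : a 1 = 0 := pow_eq_zero_iff two_ne_zero |>.1 (by linarith)
    have z2 : a 2 = 0 := by
      have : a 2 ^ 2 * (x ⬝ᵥ x) = 0 := by linarith
      exact pow_eq_zero_iff two_ne_zero |>.1 ((mul_eq_zero.1 this).resolve_right hxx.ne')
    ext i
    fin_cases i <;> simp [z0, z1, z2]
  have hlow : ν * (y ⬝ᵥ y) ≤ y ⬝ᵥ (B *ᵥ y) := by
    rw [hyy, hyBy]
    have m0 := mul_le_mul_of_nonneg_left (hν 0) (sq_nonneg (a 0))
    have m1 := mul_le_mul_of_nonneg_left (hν 1) (sq_nonneg (a 1))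
    linarith
  exact le_of_mul_le_mul_right (hlow.trans hyW) hypos

/-- With Π = `Uᵀ * U`, (1 - Π)P z = (1 - Π)B z - (1 - Π)W z. The operator (1 - Π)B is `B` on the
complement of the leading eigenvectors, of norm at most `b`: above by Weyl, below because `P` is
positive semidefinite. -/
theorem mulVec_residual_le (hB : B.IsSymm) (hU : IsLeadingEigenvectors B U) (hBPW : B = P + W)
    (hb : 0 ≤ b) (hW : ∀ x, |x ⬝ᵥ (W *ᵥ x)| ≤ b * (x ⬝ᵥ x)) (hP0 : ∀ x, 0 ≤ x ⬝ᵥ (P *ᵥ x))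
    {p₁ p₂ : Fin n → ℝ} (hP : ∀ x, p₁ ⬝ᵥ x = 0 → p₂ ⬝ᵥ x = 0 → P *ᵥ x = 0) (z : Fin n → ℝ) :
    (P *ᵥ z - Uᵀ *ᵥ (U *ᵥ (P *ᵥ z))) ⬝ᵥ (P *ᵥ z - Uᵀ *ᵥ (U *ᵥ (P *ᵥ z)))
      ≤ 2 * b ^ 2 * (z ⬝ᵥ z) + 2 * ((W *ᵥ z) ⬝ᵥ (W *ᵥ z)) := by
  obtain ⟨hUU, ρ, hρ, hmax⟩ := hU
  have hBU : B * Uᵀ = Uᵀ * Matrix.diagonal ρ := by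
    ext i k
    have := congrFun (hρ k) i
    rw [Matrix.mul_diagonal]
    rw [Pi.smul_apply, smul_eq_mul, mul_comm] at this
    exact this
  have hUB : U * B = Matrix.diagonal ρ * U := by
    have := congrArg Matrix.transpose hBU
    rwa [Matrix.transpose_mul, Matrix.transpose_mul, hB.eq, Matrix.transpose_transpose,
      Matrix.diagonal_transpose] at this
  set H := B - Uᵀ * Matrix.diagonal ρ * U with hH
  have hHs : H.IsSymm := by
    rw [Matrix.IsSymm, hH, Matrix.transpose_sub, hB.eq, Matrix.transpose_mul, Matrix.transpose_mul,
      Matrix.transpose_transpose, Matrix.diagonal_transpose, Matrix.mul_assoc]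
  have hUH : U * H = 0 := by
    rw [hH, Matrix.mul_sub, hUB, ← Matrix.mul_assoc, ← Matrix.mul_assoc, hUU, Matrix.one_mul, sub_self]
  have hHev : ∀ (ν : ℝ) (x : Fin n → ℝ), x ≠ 0 → H *ᵥ x = ν • x → |ν| ≤ b := by
    intro ν x hx hνx
    by_cases hν0 : ν = 0
    · rw [hν0, abs_zero]; exact hb
    -- An eigenvector of `H` with nonzero eigenvalue lies in the range of `H`, which `U` kills, so
    -- it is an eigenvector of `B` too.
    have hUx : U *ᵥ x = 0 := by
      have : ν • (U *ᵥ x) = 0 := by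
        rw [← Matrix.mulVec_smul, ← hνx, Matrix.mulVec_mulVec, hUH, Matrix.zero_mulVec]
      exact (smul_eq_zero.1 this).resolve_left hν0
    have hBx : B *ᵥ x = ν • x := by
      rw [← hνx, hH, Matrix.sub_mulVec, ← Matrix.mulVec_mulVec, hUx, Matrix.mulVec_zero, sub_zero]
    have hup := eigenvalue_le_of_orthogonal hUU hρ hBPW hW hP hx hUx hBx (hmax x ν hx hUx hBx)
    have hxx := dotProduct_self_pos' hx
    have hlow : -b * (x ⬝ᵥ x) ≤ ν * (x ⬝ᵥ x) := by
      calc -b * (x ⬝ᵥ x) ≤ x ⬝ᵥ (W *ᵥ x) := by linarith [(abs_le.1 (hW x)).1]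
        _ ≤ x ⬝ᵥ (P *ᵥ x) + x ⬝ᵥ (W *ᵥ x) := by linarith [hP0 x]
        _ = ν * (x ⬝ᵥ x) := by
            rw [← dotProduct_add, ← Matrix.add_mulVec, ← hBPW, hBx, dotProduct_smul, smul_eq_mul]
    exact abs_le.2 ⟨le_of_mul_le_mul_right hlow hxx, hup⟩
  have hHz : P *ᵥ z - Uᵀ *ᵥ (U *ᵥ (P *ᵥ z))
      = H *ᵥ z - (W *ᵥ z - Uᵀ *ᵥ (U *ᵥ (W *ᵥ z))) := by
    have hPB : P = B - W := by rw [hBPW, add_sub_cancel_right]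
    have : Uᵀ *ᵥ (U *ᵥ (B *ᵥ z)) = (Uᵀ * Matrix.diagonal ρ * U) *ᵥ z := by
      rw [Matrix.mulVec_mulVec, Matrix.mulVec_mulVec, Matrix.mul_assoc, hUB, Matrix.mul_assoc]
    rw [hPB, hH, Matrix.sub_mulVec, Matrix.sub_mulVec, Matrix.mulVec_sub, Matrix.mulVec_sub, this]
    abel
  rw [hHz]
  refine (sub_dotProduct_sub_le _ _).trans ?_
  rw [residual_dotProduct_self_le hUU]
  have h1 := mulVec_dotProduct_self_le_of_eigenvalues hHs hHev z
  have h2 := dotProduct_self_nonneg' (U *ᵥ (W *ᵥ z))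
  linarith

end Leading

/-! ### Extreme points of the projected cube -/

/-- Take e to be a vertex of the cube maximizing w = `Uᵀ *ᵥ u`. Then `w i * e i ≥ 0`, so wherever e
and c disagree w has the wrong sign for c (or vanishes) and `(c i - w i) ^ 2 ≥ 1`. Nothing is
assumed of `U`, as the first bound of the theorem requires. -/
theorem exists_extremeLabel_near {n m : ℕ} (U : Matrix (Fin m) (Fin n) ℝ) (u : Fin m → ℝ)
    {c : Fin n → ℝ} (hc : ∀ i, c i = 1 ∨ c i = -1) :
    ∃ e ∈ extremeLabels U, ({i | e i ≠ c i}.ncard : ℝ) ≤ (c - Uᵀ *ᵥ u) ⬝ᵥ (c - Uᵀ *ᵥ u) := by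
  classical
  set cube : Set (Fin n → ℝ) := Set.pi Set.univ fun _ => Set.Icc (-1 : ℝ) 1 with hcube
  have hcube_eq : {x : Fin n → ℝ | ∀ i, x i ∈ Set.Icc (-1 : ℝ) 1} = cube := by
    ext x; simp only [hcube, Set.mem_ofPred_eq, Set.mem_pi, Set.mem_univ, forall_const]
  have hcc : IsCompact cube := isCompact_univ_pi fun _ => isCompact_Icc
  have hU : Continuous fun x : Fin n → ℝ => U *ᵥ x := by fun_prop
  have hK : IsCompact (projectedCube U) := by
    rw [projectedCube, hcube_eq]; exact hcc.image hU
  have h0 : (0 : Fin n → ℝ) ∈ cube := fun i _ => by simp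
  have hKne : (projectedCube U).Nonempty := by
    rw [projectedCube, hcube_eq]; exact ⟨_, 0, h0, rfl⟩
  set f : (Fin m → ℝ) →L[ℝ] ℝ := LinearMap.toContinuousLinearMap
    { toFun := fun p => u ⬝ᵥ p
      map_add' := fun p s => dotProduct_add _ _ _
      map_smul' := fun a p => dotProduct_smul _ _ _ } with hf
  have hfa : ∀ p, f p = u ⬝ᵥ p := fun p => rfl
  set F := {p ∈ projectedCube U | ∀ s ∈ projectedCube U, f s ≤ f p} with hF
  have hFexp : IsExposed ℝ (projectedCube U) F := fun _ => ⟨f, rfl⟩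
  obtain ⟨p0, hp0, hp0max⟩ := hK.exists_isMaxOn hKne f.continuous.continuousOn
  have hFne : F.Nonempty := ⟨p0, hp0, fun s hs => hp0max hs⟩
  obtain ⟨p, hp⟩ := (hFexp.isCompact hK).extremePoints_nonempty hFne
  have hpK : p ∈ (projectedCube U).extremePoints ℝ :=
    hFexp.isExtreme.extremePoints_subset_extremePoints hp
  have hpF : p ∈ F := hp.1
  -- The fibre over an extreme point is a face of the cube, so it has an extreme point, which is a
  -- vertex of the cube.
  set G := {x ∈ cube | U *ᵥ x = p} with hG
  have hGext : IsExtreme ℝ cube G := by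
    refine ⟨fun x hx => hx.1, fun x hx y hy w hw hwo => ?_⟩
    obtain ⟨a, b, ha, hb, hab, rfl⟩ := hwo
    have hmem : ∀ x ∈ cube, U *ᵥ x ∈ projectedCube U := fun x hx => by
      rw [projectedCube, hcube_eq]; exact ⟨x, hx, rfl⟩
    have hop : p ∈ openSegment ℝ (U *ᵥ x) (U *ᵥ y) := by
      refine ⟨a, b, ha, hb, hab, ?_⟩
      rw [← hw.2, Matrix.mulVec_add, Matrix.mulVec_smul, Matrix.mulVec_smul]
    exact ⟨hx, (mem_extremePoints.1 hpK).2 _ (hmem x hx) _ (hmem y hy) hop |>.1⟩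
  have hGc : IsCompact G := hcc.inter_right (isClosed_singleton.preimage hU)
  have hGne : G.Nonempty := by
    have := hpK.1
    rw [projectedCube, hcube_eq] at this
    obtain ⟨x, hx, hxp⟩ := this
    exact ⟨x, hx, hxp⟩
  obtain ⟨e, he⟩ := hGc.extremePoints_nonempty hGne
  have heG : e ∈ G := he.1
  have hecube : e ∈ cube.extremePoints ℝ := hGext.extremePoints_subset_extremePoints he
  have hepm : ∀ i, e i = 1 ∨ e i = -1 := by
    intro i
    rw [hcube, extremePoints_pi] at hecube
    have := hecube i (Set.mem_univ i)
    rw [Set.extremePoints_Icc (by norm_num)] at this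
    exact this.symm
  refine ⟨e, ⟨hepm, by rw [heG.2]; exact hpK⟩, ?_⟩
  set w := Uᵀ *ᵥ u with hw
  have hfw : ∀ x, f (U *ᵥ x) = w ⬝ᵥ x := fun x => by
    rw [hfa, hw, Matrix.dotProduct_mulVec, Matrix.mulVec_transpose]
  have hmax : ∀ x ∈ cube, w ⬝ᵥ x ≤ w ⬝ᵥ e := by
    intro x hx
    rw [← hfw, ← hfw, heG.2]
    refine hpF.2 _ ?_
    rw [projectedCube, hcube_eq]
    exact ⟨x, hx, rfl⟩
  have hsign : ∀ i, 0 ≤ w i * e i := by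
    intro i
    -- Flipping one coordinate stays in the cube and cannot increase w.
    have hx : Function.update e i (-e i) ∈ cube := by
      intro j _
      by_cases hj : j = i
      · subst hj
        rw [Function.update_self]
        rcases hepm j with h | h <;> rw [h] <;> norm_num
      · rw [Function.update_of_ne hj]
        exact heG.1 j (Set.mem_univ j)
    have h1 := hmax _ hx
    have h2 : Function.update e i (-e i) = e - Pi.single i (2 * e i) := by
      ext j
      by_cases hj : j = i
      · subst hj; simp; ring
      · simp [hj]
    rw [h2, dotProduct_sub, dotProduct_single] at h1
    linarith
  rw [dotProduct_eq_sum_sq, Set.ncard_eq_toFinset_card', Finset.card_eq_sum_ones]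
  push_cast
  refine (Finset.sum_le_sum fun i hi => ?_).trans (Finset.sum_le_sum_of_subset_of_nonneg
    (Finset.subset_univ {i | e i ≠ c i}.toFinset) fun i _ _ => sq_nonneg ((c - w) i))
  have hne : e i ≠ c i := by simpa using hi
  have hs := hsign i
  rw [Pi.sub_apply]
  rcases hepm i with h | h <;> rcases hc i with h' | h' <;> rw [h] at hs hne <;> rw [h'] at hne ⊢
  · exact absurd rfl hne
  · nlinarith
  · nlinarith
  · exact absurd rfl hne

/-! ### The mean matrix -/

/-- The indicator of the community. -/
noncomputable def chi (n n₁ : ℕ) (i : Fin n) : ℝ := if i.val < n₁ then 1 else 0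

section Mean

variable {n n₁ : ℕ} {lam r : ℝ}

theorem chi_zero_or_one (i : Fin n) : chi n n₁ i = 0 ∨ chi n n₁ i = 1 := by
  unfold chi; split_ifs <;> simp

theorem meanMatrix_apply (i j : Fin n) :
    meanMatrix n n₁ lam r i j = lam / n * ((1 - r) * chi n n₁ i * chi n n₁ j + r) := by
  simp only [meanMatrix, blockProb, community, chi, Matrix.of_apply, Matrix.smul_apply]
  split_ifs <;> simp

theorem meanMatrix_isSymm : (meanMatrix n n₁ lam r).IsSymm := by
  ext i j
  rw [Matrix.transpose_apply, meanMatrix_apply, meanMatrix_apply]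
  ring

theorem meanMatrix_mulVec (z : Fin n → ℝ) (i : Fin n) : (meanMatrix n n₁ lam r *ᵥ z) i
    = lam / n * ((1 - r) * (chi n n₁ ⬝ᵥ z) * chi n n₁ i + r * ∑ j, z j) := by
  simp only [Matrix.mulVec, dotProduct, meanMatrix_apply, Finset.mul_sum, Finset.sum_mul,
    ← Finset.sum_add_distrib]
  exact Finset.sum_congr rfl fun j _ => by ring

theorem dotProduct_meanMatrix_mulVec (x y : Fin n → ℝ) : x ⬝ᵥ (meanMatrix n n₁ lam r *ᵥ y)
    = lam / n * ((1 - r) * (chi n n₁ ⬝ᵥ x) * (chi n n₁ ⬝ᵥ y) + r * (∑ i, x i) * ∑ j, y j) := by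
  have : ∀ i, x i * (meanMatrix n n₁ lam r *ᵥ y) i
      = lam / n * (1 - r) * (chi n n₁ ⬝ᵥ y) * (chi n n₁ i * x i)
        + lam / n * r * (∑ j, y j) * x i := fun i => by rw [meanMatrix_mulVec]; ring
  rw [dotProduct, Finset.sum_congr rfl fun i _ => this i, Finset.sum_add_distrib, ← Finset.mul_sum,
    ← Finset.mul_sum, ← dotProduct]
  ring

theorem sum_chi (h : n₁ ≤ n) : ∑ i, chi n n₁ i = n₁ := by
  simp only [chi]
  rw [Finset.sum_boole]
  congr 1
  exact Fin.card_filter_val_lt.trans (min_eq_right h)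

theorem trueLabel_eq (i : Fin n) : trueLabel n n₁ i = 2 * chi n n₁ i - 1 := by
  simp only [trueLabel, chi]; split_ifs <;> norm_num

theorem trueLabel_eq_or (i : Fin n) : trueLabel n n₁ i = 1 ∨ trueLabel n n₁ i = -1 := by
  simp only [trueLabel]; split_ifs <;> simp

/-- The true labels are the image under the mean matrix of a small vector. -/
theorem exists_preimage_trueLabel {κ : ℝ} (hκ : 0 < κ) (hlam : 0 < lam) (hn : 0 < n) (hr : κ ≤ r)
    (hr₁ : κ ≤ 1 - r) (h₁ : κ * n ≤ n₁) (h₂ : κ * n ≤ n - n₁) :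
    ∃ z, meanMatrix n n₁ lam r *ᵥ z = trueLabel n n₁ ∧ z ⬝ᵥ z ≤ 8 / κ ^ 5 * n / lam ^ 2 := by
  have hn0 : (0:ℝ) < n := by exact_mod_cast hn
  have hn1 : (0:ℝ) < n₁ := lt_of_lt_of_le (by positivity) h₁
  have hn2 : (0:ℝ) < n - n₁ := lt_of_lt_of_le (by positivity) h₂
  have hle : n₁ ≤ n := by
    have : (n₁:ℝ) ≤ n := by linarith
    exact_mod_cast this
  have hr0 : 0 < r := by linarith
  have hr10 : 0 < 1 - r := by linarith
  -- `a` and `b` are the values of z on the two communities. They solve the 2×2 system requiring `P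
  -- z` to be 1 on the first and -1 on the second.
  set a : ℝ := n / lam * (2 / (1 - r)) / n₁ with ha
  set b : ℝ := - (n / lam * ((1 + r) / (r * (1 - r)))) / (n - n₁) with hb
  have han : a * n₁ = n / lam * (2 / (1 - r)) := by rw [ha]; field_simp
  have hbn : b * (n - n₁) = - (n / lam * ((1 + r) / (r * (1 - r)))) := by
    rw [hb]; field_simp
  set z : Fin n → ℝ := fun i => b + (a - b) * chi n n₁ i with hz
  have hs : ∑ i, z i = b * (n - n₁) + a * n₁ := by
    simp only [hz, Finset.sum_add_distrib, ← Finset.mul_sum, sum_chi hle]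
    simp
    ring
  have hc : chi n n₁ ⬝ᵥ z = a * n₁ := by
    have : chi n n₁ ⬝ᵥ z = ∑ i, a * chi n n₁ i := by
      refine Finset.sum_congr rfl fun i _ => ?_
      rcases chi_zero_or_one (n₁ := n₁) i with h | h <;> simp [hz, h]
    rw [this, ← Finset.mul_sum, sum_chi hle]
  have hzz : z ⬝ᵥ z = b ^ 2 * (n - n₁) + a ^ 2 * n₁ := by
    have : z ⬝ᵥ z = ∑ i, (b ^ 2 + (a ^ 2 - b ^ 2) * chi n n₁ i) := by
      refine Finset.sum_congr rfl fun i _ => ?_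
      rcases chi_zero_or_one (n₁ := n₁) i with h | h <;> simp [hz, h] <;> ring
    rw [this, Finset.sum_add_distrib, ← Finset.mul_sum, sum_chi hle]
    simp
    ring
  refine ⟨z, ?_, ?_⟩
  · ext i
    rw [meanMatrix_mulVec, hs, hc, han, hbn, trueLabel_eq]
    field_simp
    ring
  · have e1 : b ^ 2 * (n - n₁) = (n / lam) ^ 2 * ((1 + r) / (r * (1 - r))) ^ 2 / (n - n₁) := by
      rw [hb]; field_simp
    have e2 : a ^ 2 * n₁ = (n / lam) ^ 2 * (2 / (1 - r)) ^ 2 / n₁ := by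
      rw [ha]; field_simp
    have hκ1 : κ ≤ 1 := by linarith
    have f1 : (1 + r) / (r * (1 - r)) ≤ 2 / κ ^ 2 := by
      rw [sq]
      gcongr
      linarith
    have f2 : 2 / (1 - r) ≤ 2 / κ ^ 2 := by
      gcongr
      nlinarith
    rw [hzz, e1, e2]
    calc _ ≤ (n / lam) ^ 2 * (2 / κ ^ 2) ^ 2 / (κ * n) + (n / lam) ^ 2 * (2 / κ ^ 2) ^ 2 / (κ * n) := by
          gcongr
      _ = _ := by field_simp; ring

end Mean

/-! ### The noise matrix -/

section Noise

variable {n n₁ : ℕ} {q r : ℝ} {B P : Matrix (Fin n) (Fin n) ℝ}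

theorem bilin_sub_eq (hB : B.IsSymm) (hP : P.IsSymm) (x y : Fin n → ℝ) :
    x ⬝ᵥ ((B - P) *ᵥ y) = ∑ i, ∑ j, x i * lowerPart B P i j * y j
      + ∑ i, ∑ j, y i * lowerPart B P i j * x j + ∑ i, x i * (B i i - P i i) * y i := by
  have hentry : ∀ i j, (B - P) i j = lowerPart B P i j + lowerPart B P j i
      + (if i = j then B i i - P i i else 0) := by
    intro i j
    simp only [lowerPart, Matrix.of_apply, Matrix.sub_apply]
    rcases lt_trichotomy i j with h | h | h
    · rw [if_neg h.not_gt, if_pos h, if_neg h.ne, hB.apply j i, hP.apply j i]; ring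
    · subst h; simp
    · rw [if_pos h, if_neg h.not_gt, if_neg h.ne']; ring
  have h2 : ∑ i, ∑ j, y i * lowerPart B P i j * x j = ∑ i, ∑ j, x i * lowerPart B P j i * y j := by
    rw [Finset.sum_comm]
    exact Finset.sum_congr rfl fun i _ => Finset.sum_congr rfl fun j _ => by ring
  have h3 : ∑ i, x i * (B i i - P i i) * y i
      = ∑ i, ∑ j, x i * (if i = j then B i i - P i i else 0) * y j := by
    refine Finset.sum_congr rfl fun i _ => ?_
    simp
  rw [h2, h3]
  simp only [dotProduct, Matrix.mulVec, Finset.mul_sum, ← Finset.sum_add_distrib]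
  refine Finset.sum_congr rfl fun i _ => Finset.sum_congr rfl fun j _ => ?_
  rw [hentry]
  ring

theorem abs_diag_bilin_le {D : Fin n → ℝ} (hD : ∀ i, |D i| ≤ 1) (x y : Fin n → ℝ) :
    |∑ i, x i * D i * y i| ≤ (x ⬝ᵥ x + y ⬝ᵥ y) / 2 := by
  rw [dotProduct_eq_sum_sq, dotProduct_eq_sum_sq, ← Finset.sum_add_distrib, Finset.sum_div]
  refine (Finset.abs_sum_le_sum_abs _ _).trans (Finset.sum_le_sum fun i _ => ?_)
  rw [abs_mul, abs_mul]
  calc |x i| * |D i| * |y i| ≤ |x i| * 1 * |y i| := by gcongr; exact hD i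
    _ ≤ _ := by nlinarith [sq_nonneg (|x i| - |y i|), sq_abs (x i), sq_abs (y i)]

theorem abs_noise_bilin_le (hq : 1 ≤ q) (hg : ∃ g : ℕ, 4 * (g:ℝ) + 3 ≤ q ∧ q ^ 7 ≤ 2 ^ g)
    (hB : B.IsSymm) (hP : P.IsSymm) (hD : ∀ i, |B i i - P i i| ≤ 1)
    (hreg : IsRegular q (lowerPart B P)) (x y : Fin n → ℝ) :
    |x ⬝ᵥ ((B - P) *ᵥ y)| ≤ 5 * q ^ 15 * (x ⬝ᵥ x + y ⬝ᵥ y) := by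
  obtain ⟨g, hg1, hg2⟩ := hg
  have hq0 : 0 < q := by linarith
  -- The cutoff `g` makes the far term at most q^14; with the near term this gives q^14 (4g + 3) ≤
  -- q^15.
  have hb : 2 * q ^ 14 * (2 * g + 1) + q ^ 21 / 2 ^ g ≤ q ^ 15 := by
    have : q ^ 21 / 2 ^ g ≤ q ^ 14 := by
      rw [div_le_iff₀ (by positivity)]
      calc q ^ 21 = q ^ 14 * q ^ 7 := by ring
        _ ≤ _ := by gcongr
    calc _ ≤ 2 * q ^ 14 * (2 * g + 1) + q ^ 14 := by gcongr
      _ = q ^ 14 * (4 * g + 3) := by ring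
      _ ≤ q ^ 14 * q := by gcongr
      _ = _ := by ring
  have h := fun x y : Fin n → ℝ => abs_bilin_le (by positivity) hreg.disc_le hreg.row_le
    hreg.col_le g x y
  have hxx := dotProduct_self_nonneg' x
  have hyy := dotProduct_self_nonneg' y
  have h' : ∀ x y : Fin n → ℝ, 0 ≤ x ⬝ᵥ x + y ⬝ᵥ y →
      |∑ i, ∑ j, x i * lowerPart B P i j * y j| ≤ 2 * q ^ 15 * (x ⬝ᵥ x + y ⬝ᵥ y) := by
    intro x y h0
    refine (h x y).trans ?_
    rw [← dotProduct_eq_sum_sq, ← dotProduct_eq_sum_sq]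
    gcongr
  rw [bilin_sub_eq hB hP]
  refine (abs_add_le _ _).trans ((add_le_add_left (abs_add_le _ _) _).trans ?_)
  have h1 := h' x y (by linarith)
  have h2 := h' y x (by linarith)
  have h3 := abs_diag_bilin_le hD x y
  have h4 : 1 ≤ q ^ 15 := one_le_pow₀ hq
  nlinarith

theorem noise_mulVec_le {W : Matrix (Fin n) (Fin n) ℝ} {b : ℝ} (hb : 0 < b)
    (hW : ∀ x y, |x ⬝ᵥ (W *ᵥ y)| ≤ b * (x ⬝ᵥ x + y ⬝ᵥ y)) (x : Fin n → ℝ) :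
    (W *ᵥ x) ⬝ᵥ (W *ᵥ x) ≤ (2 * b) ^ 2 * (x ⬝ᵥ x) := by
  -- Testing `W x` against a multiple of x turns the form bound into a norm bound; the multiple 2b
  -- balances the two squares.
  have h := (le_abs_self _).trans (hW (W *ᵥ x) ((2 * b) • x))
  simp only [Matrix.mulVec_smul, dotProduct_smul, smul_dotProduct, smul_eq_mul] at h
  have h2 : b * ((W *ᵥ x) ⬝ᵥ (W *ᵥ x)) ≤ b * ((2 * b) ^ 2 * (x ⬝ᵥ x)) := by linarith
  exact le_of_mul_le_mul_left h2 hb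

theorem sum_sq_le_of_zero_or_one {s : Fin n → ℝ} (hs : ∀ i, s i = 0 ∨ s i = 1) :
    s ⬝ᵥ s = ∑ i, s i :=
  Finset.sum_congr rfl fun i _ => by rcases hs i with h | h <;> rw [h] <;> simp

theorem sum_le_card_of_zero_or_one {s : Fin n → ℝ} (hs : ∀ i, s i = 0 ∨ s i = 1) :
    ∑ i, s i ≤ n := by
  calc ∑ i, s i ≤ ∑ _i : Fin n, (1:ℝ) :=
        Finset.sum_le_sum fun i _ => by rcases hs i with h | h <;> simp [h]
    _ = n := by simp

theorem abs_noise_cut_le (hq : 1 ≤ q) (hB : B.IsSymm) (hP : P.IsSymm)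
    (hD : ∀ i, |B i i - P i i| ≤ 1) (hreg : IsRegular q (lowerPart B P)) {s t : Fin n → ℝ}
    (hs : ∀ i, s i = 0 ∨ s i = 1) (ht : ∀ i, t i = 0 ∨ t i = 1) :
    |s ⬝ᵥ ((B - P) *ᵥ t)| ≤ 9 * n * q ^ 10 := by
  classical
  have hcut : ∀ s t : Fin n → ℝ, (∀ i, s i = 0 ∨ s i = 1) → (∀ i, t i = 0 ∨ t i = 1) →
      |∑ i, ∑ j, s i * lowerPart B P i j * t j| ≤ 4 * n * q ^ 10 := by
    intro s t hs ht
    have : ∑ i, ∑ j, s i * lowerPart B P i j * t j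
        = cut (lowerPart B P) (Finset.univ.filter fun i => s i = 1)
          (Finset.univ.filter fun i => t i = 1) := by
      rw [cut, Finset.sum_filter]
      refine Finset.sum_congr rfl fun i _ => ?_
      rw [Finset.sum_filter]
      rcases hs i with h | h
      · simp [h]
      · rw [if_pos h]
        refine Finset.sum_congr rfl fun j _ => ?_
        rcases ht j with h' | h' <;> simp [h, h']
    rw [this]
    exact hreg.cut_le _ _
  rw [bilin_sub_eq hB hP]
  refine (abs_add_le _ _).trans ((add_le_add_left (abs_add_le _ _) _).trans ?_)
  have h1 := hcut s t hs ht
  have h2 := hcut t s ht hs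
  have h3 := abs_diag_bilin_le hD s t
  rw [sum_sq_le_of_zero_or_one hs, sum_sq_le_of_zero_or_one ht] at h3
  have h4 := sum_le_card_of_zero_or_one hs
  have h5 := sum_le_card_of_zero_or_one ht
  have h6 : (n:ℝ) * 1 ≤ n * q ^ 10 := by gcongr; exact one_le_pow₀ hq
  linarith

end Noise

/-! ### The extraction criterion -/

/-- The `0`-`1` vector of the nodes labelled `1`. -/
noncomputable def ind {n : ℕ} (e : Fin n → ℝ) (i : Fin n) : ℝ := (1 + e i) / 2

section Criterion

variable {n n₁ : ℕ} {r lam κ : ℝ} {e : Fin n → ℝ}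

theorem ind_zero_or_one (he : ∀ i, e i = 1 ∨ e i = -1) (i : Fin n) : ind e i = 0 ∨ ind e i = 1 := by
  unfold ind
  rcases he i with h | h <;> rw [h] <;> norm_num

theorem qEX_eq (B : Matrix (Fin n) (Fin n) ℝ) (e : Fin n → ℝ) :
    qEX B e = (n - ∑ i, ind e i) / (∑ i, ind e i) * (ind e ⬝ᵥ (B *ᵥ ind e))
      - ind e ⬝ᵥ (B *ᵥ (1 - ind e)) := by
  have h1 : (1 + e : Fin n → ℝ) = (2:ℝ) • ind e := by
    ext i; simp [ind]; ring
  have h2 : (1 - e : Fin n → ℝ) = (2:ℝ) • (1 - ind e) := by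
    ext i; simp [ind]; ring
  have h3 : (1 - ind e) ⬝ᵥ (1 : Fin n → ℝ) = n - ∑ i, ind e i := by
    rw [dotProduct_one]; simp
  have h4 : ((2:ℝ) • ind e) ⬝ᵥ (1 : Fin n → ℝ) = 2 * ∑ i, ind e i := by
    rw [smul_dotProduct, dotProduct_one, smul_eq_mul]
  have h5 : ((2:ℝ) • (1 - ind e)) ⬝ᵥ (1 : Fin n → ℝ) = 2 * (n - ∑ i, ind e i) := by
    rw [smul_dotProduct, h3, smul_eq_mul]
  unfold qEX size₁ size₂ O₁₁ O₁₂
  rw [h1, h2, h4, h5]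
  simp only [Matrix.mulVec_smul, smul_dotProduct, dotProduct_smul, smul_eq_mul]
  ring

theorem qEX_sub (B P : Matrix (Fin n) (Fin n) ℝ) (e : Fin n → ℝ) :
    qEX (B - P) e = qEX B e - qEX P e := by
  simp only [qEX_eq, Matrix.sub_mulVec, dotProduct_sub]
  ring

theorem ncard_ne_eq (he : ∀ i, e i = 1 ∨ e i = -1) (h : n₁ ≤ n) :
    ({i | e i ≠ trueLabel n n₁ i}.ncard : ℝ)
      = n₁ + ∑ i, ind e i - 2 * (chi n n₁ ⬝ᵥ ind e) := by
  classical
  rw [Set.ncard_eq_toFinset_card', Set.toFinset_ofPred, ← Finset.sum_boole, ← sum_chi h, dotProduct,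
    Finset.mul_sum, ← Finset.sum_add_distrib, ← Finset.sum_sub_distrib]
  refine Finset.sum_congr rfl fun i _ => ?_
  rw [trueLabel_eq, ind]
  rcases chi_zero_or_one (n₁ := n₁) i with h | h <;> rcases he i with h' | h' <;> rw [h, h'] <;>
    norm_num

theorem norm_trueLabel_sub_sq (he : ∀ i, e i = 1 ∨ e i = -1) (h : n₁ ≤ n) :
    ‖WithLp.toLp 2 (trueLabel n n₁ - e)‖ ^ 2 = 4 * ({i | e i ≠ trueLabel n n₁ i}.ncard : ℝ) := by
  rw [ncard_ne_eq he h, EuclideanSpace.norm_sq_eq, ← sum_chi h, dotProduct, Finset.mul_sum,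
    ← Finset.sum_add_distrib, ← Finset.sum_sub_distrib, Finset.mul_sum]
  refine Finset.sum_congr rfl fun i _ => ?_
  simp only [norm_eq_abs, sq_abs, Pi.sub_apply]
  rw [trueLabel_eq, ind]
  rcases chi_zero_or_one (n₁ := n₁) i with h | h <;> rcases he i with h' | h' <;> rw [h, h'] <;>
    norm_num

theorem ind_bounds (he : ∀ i, e i = 1 ∨ e i = -1) (h : n₁ ≤ n) :
    0 ≤ chi n n₁ ⬝ᵥ ind e ∧ chi n n₁ ⬝ᵥ ind e ≤ n₁ ∧ chi n n₁ ⬝ᵥ ind e ≤ ∑ i, ind e i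
      ∧ ∑ i, ind e i ≤ n := by
  have hs := ind_zero_or_one he
  refine ⟨Finset.sum_nonneg fun i _ => ?_, ?_, Finset.sum_le_sum fun i _ => ?_,
    sum_le_card_of_zero_or_one hs⟩
  · rcases hs i with h1 | h1 <;> rcases chi_zero_or_one (n₁ := n₁) i with h2 | h2 <;> simp [h1, h2]
  · rw [← sum_chi h]
    refine Finset.sum_le_sum fun i _ => ?_
    rcases hs i with h1 | h1 <;> rcases chi_zero_or_one (n₁ := n₁) i with h2 | h2 <;> simp [h1, h2]
  · rcases hs i with h1 | h1 <;> rcases chi_zero_or_one (n₁ := n₁) i with h2 | h2 <;> simp [h1, h2]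

/-- The constant part r of the mean cancels: the criterion vanishes on a constant matrix. Only the
overlap with the community and the size of the labelled set remain. -/
theorem qEX_meanMatrix (he : ∀ i, e i = 1 ∨ e i = -1) (hn : 0 < n) (h : n₁ ≤ n) :
    qEX (meanMatrix n n₁ lam r) e = lam * (1 - r) *
      ((chi n n₁ ⬝ᵥ ind e) ^ 2 / (∑ i, ind e i) - n₁ / n * (chi n n₁ ⬝ᵥ ind e)) := by
  obtain ⟨b1, b2, b3, b4⟩ := ind_bounds (n₁ := n₁) he h
  have hn0 : (n:ℝ) ≠ 0 := by positivity
  rw [qEX_eq, dotProduct_meanMatrix_mulVec, dotProduct_meanMatrix_mulVec]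
  have h1 : chi n n₁ ⬝ᵥ (1 - ind e) = n₁ - chi n n₁ ⬝ᵥ ind e := by
    rw [dotProduct_sub, dotProduct_one, sum_chi h]
  have h2 : ∑ i, (1 - ind e : Fin n → ℝ) i = n - ∑ i, ind e i := by simp
  rw [h1, h2]
  set X := chi n n₁ ⬝ᵥ ind e
  set σ := ∑ i, ind e i
  by_cases hσ : σ = 0
  · have : X = 0 := by linarith
    rw [hσ, this]; simp
  · field_simp
    ring

/-- The criterion of the mean matrix falls off linearly with the number of mislabelled nodes. -/
theorem gap_bounds {n n₁ X σ κ : ℝ} (hκ : 0 < κ) (hn : 0 < n) (h₁ : κ * n ≤ n₁)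
    (h₂ : κ * n ≤ n - n₁) (hX0 : 0 ≤ X) (hX : X ≤ n₁) (hXσ : X ≤ σ) (hσ : σ ≤ n)
    (hmis : n₁ + σ - 2 * X ≤ n) :
    n₁ * (n - n₁) / n - (n₁ + σ - 2 * X) ≤ X ^ 2 / σ - n₁ / n * X ∧
    X ^ 2 / σ - n₁ / n * X ≤ n₁ * (n - n₁) / n - κ ^ 2 / 2 * (n₁ + σ - 2 * X) := by
  have hn1 : 0 < n₁ := lt_of_lt_of_le (by positivity) h₁
  have hn2 : 0 < n - n₁ := lt_of_lt_of_le (by positivity) h₂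
  have hp1 : κ ≤ n₁ / n := by rwa [le_div_iff₀ hn]
  have hp2 : κ ≤ (n - n₁) / n := by rwa [le_div_iff₀ hn]
  have hp2' : (n - n₁) / n ≤ 1 := by rw [div_le_one hn]; linarith
  have hp1' : n₁ / n ≤ 1 := by rw [div_le_one hn]; linarith
  have hY : 0 ≤ σ - X := by linarith
  -- The loss splits into missed members, with weight (n - n₁)/n, and intruders, with weight X/σ.
  have key : X ^ 2 / σ - n₁ / n * X
      = n₁ * (n - n₁) / n - ((n - n₁) / n * (n₁ - X) + X / σ * (σ - X)) := by
    by_cases hσ0 : σ = 0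
    · have : X = 0 := by linarith
      rw [this, hσ0]; simp; ring
    · field_simp
      ring
  rw [key]
  have hXσ1 : X / σ ≤ 1 := div_le_one_of_le₀ hXσ (by linarith)
  have hXσ0 : 0 ≤ X / σ := div_nonneg hX0 (by linarith)
  constructor
  · have e1 : (n - n₁) / n * (n₁ - X) ≤ 1 * (n₁ - X) :=
      mul_le_mul_of_nonneg_right hp2' (by linarith)
    have e2 : X / σ * (σ - X) ≤ 1 * (σ - X) := mul_le_mul_of_nonneg_right hXσ1 hY
    linarith
  · have hκ1 : κ ≤ 1 := by linarith
    -- The weight X/σ is bounded below only if half of the community is found. Otherwise the missed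
    -- members alone cost at least κ²n/2, enough because there are at most n errors.
    rcases le_total (n₁ / 2) X with hc | hc
    · have hσ0 : 0 < σ := by linarith
      have f1 : κ / 2 ≤ X / σ := by
        rw [le_div_iff₀ hσ0]
        calc κ / 2 * σ ≤ κ / 2 * n := by gcongr
          _ ≤ _ := by linarith
      have e1 : κ * (n₁ - X) ≤ (n - n₁) / n * (n₁ - X) :=
        mul_le_mul_of_nonneg_right hp2 (by linarith)
      have e2 : κ / 2 * (σ - X) ≤ X / σ * (σ - X) := mul_le_mul_of_nonneg_right f1 hY
      have e3 : κ ^ 2 ≤ κ := by nlinarith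
      have e4 : κ ^ 2 / 2 * (n₁ - X) ≤ κ * (n₁ - X) :=
        mul_le_mul_of_nonneg_right (by linarith) (by linarith)
      have e5 : κ ^ 2 / 2 * (σ - X) ≤ κ / 2 * (σ - X) :=
        mul_le_mul_of_nonneg_right (by linarith) hY
      linarith
    · have e1 : κ * (n₁ - X) ≤ (n - n₁) / n * (n₁ - X) :=
        mul_le_mul_of_nonneg_right hp2 (by linarith)
      have e2 : κ * (κ * n / 2) ≤ κ * (n₁ - X) := by gcongr; linarith
      have e3 : 0 ≤ X / σ * (σ - X) := mul_nonneg hXσ0 hY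
      have e4 : κ ^ 2 / 2 * (n₁ + σ - 2 * X) ≤ κ ^ 2 / 2 * n := by gcongr
      nlinarith

theorem ncard_le {p : Fin n → Prop} : ({i | p i}.ncard : ℝ) ≤ n := by
  have := Set.ncard_le_card {i | p i}
  rw [Nat.card_fin] at this
  exact_mod_cast this

theorem ncard_ne_le_of_qEX_le {B : Matrix (Fin n) (Fin n) ℝ} {e' : Fin n → ℝ} {E : ℝ}
    (hκ : 0 < κ) (hlam : 0 < lam) (hn : 0 < n) (hr₁ : κ ≤ 1 - r) (h₁ : κ * n ≤ n₁)
    (h₂ : κ * n ≤ n - n₁) (he : ∀ i, e i = 1 ∨ e i = -1) (he' : ∀ i, e' i = 1 ∨ e' i = -1)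
    (hE : |qEX (B - meanMatrix n n₁ lam r) e| ≤ E) (hE' : |qEX (B - meanMatrix n n₁ lam r) e'| ≤ E)
    (hmax : qEX B e' ≤ qEX B e) :
    κ ^ 2 / 2 * ({i | e i ≠ trueLabel n n₁ i}.ncard : ℝ)
      ≤ ({i | e' i ≠ trueLabel n n₁ i}.ncard : ℝ) + 2 * E / (lam * κ) := by
  have hn0 : (0:ℝ) < n := by positivity
  have hle : n₁ ≤ n := by
    have : (0:ℝ) ≤ κ * n := by positivity
    have : (n₁:ℝ) ≤ n := by linarith
    exact_mod_cast this
  have hE0 : 0 ≤ E := (abs_nonneg _).trans hE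
  have hm := ncard_le (p := fun i => e i ≠ trueLabel n n₁ i)
  have hm' := ncard_le (p := fun i => e' i ≠ trueLabel n n₁ i)
  rw [ncard_ne_eq he hle] at hm ⊢
  rw [ncard_ne_eq he' hle] at hm' ⊢
  obtain ⟨a1, a2, a3, a4⟩ := ind_bounds (n₁ := n₁) he hle
  obtain ⟨b1, b2, b3, b4⟩ := ind_bounds (n₁ := n₁) he' hle
  obtain ⟨-, g1⟩ := gap_bounds hκ hn0 h₁ h₂ a1 a2 a3 a4 hm
  obtain ⟨g2, -⟩ := gap_bounds hκ hn0 h₁ h₂ b1 b2 b3 b4 hm'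
  rw [qEX_sub, qEX_meanMatrix he hn hle] at hE
  rw [qEX_sub, qEX_meanMatrix he' hn hle] at hE'
  set X := chi n n₁ ⬝ᵥ ind e
  set σ := ∑ i, ind e i
  set X' := chi n n₁ ⬝ᵥ ind e'
  set σ' := ∑ i, ind e' i
  have k1 := (abs_le.1 hE).2
  have k2 := (abs_le.1 hE').1
  have hr10 : 0 < 1 - r := by linarith
  have hpos : 0 < lam * (1 - r) := by positivity
  have k3 : lam * (1 - r) * (X' ^ 2 / σ' - n₁ / n * X')
      ≤ lam * (1 - r) * (X ^ 2 / σ - n₁ / n * X) + 2 * E := by linarith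
  have k4 : X' ^ 2 / σ' - n₁ / n * X' ≤ X ^ 2 / σ - n₁ / n * X + 2 * E / (lam * (1 - r)) := by
    rw [← mul_le_mul_iff_right₀ hpos, mul_add, mul_div_cancel₀ _ hpos.ne']
    exact k3
  have k5 : 2 * E / (lam * (1 - r)) ≤ 2 * E / (lam * κ) := by gcongr
  linarith

/-- The form at a 0-1 vector is at most 2b times its size σ, and this σ cancels the denominator, so
even tiny communities are covered. -/
theorem abs_qEX_noise_le {W : Matrix (Fin n) (Fin n) ℝ} {b : ℝ} (hb : 0 < b)
    (hW : ∀ x y, |x ⬝ᵥ (W *ᵥ y)| ≤ b * (x ⬝ᵥ x + y ⬝ᵥ y)) (he : ∀ i, e i = 1 ∨ e i = -1) :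
    |qEX W e| ≤ 3 * b * n := by
  have hs := ind_zero_or_one he
  have hs' : ∀ i, (1 - ind e : Fin n → ℝ) i = 0 ∨ (1 - ind e : Fin n → ℝ) i = 1 := fun i => by
    rcases hs i with h | h <;> simp [h]
  have h1 := hW (ind e) (ind e)
  have h2 := hW (ind e) (1 - ind e)
  rw [sum_sq_le_of_zero_or_one hs] at h1
  rw [sum_sq_le_of_zero_or_one hs, sum_sq_le_of_zero_or_one hs'] at h2
  have h3 : ∑ i, (1 - ind e : Fin n → ℝ) i = n - ∑ i, ind e i := by simp
  rw [h3] at h2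
  rw [qEX_eq]
  have hσn := sum_le_card_of_zero_or_one hs
  have hσ0 : 0 ≤ ∑ i, ind e i :=
    Finset.sum_nonneg fun i _ => by rcases hs i with h | h <;> rw [h]; norm_num
  set σ := ∑ i, ind e i
  have h4 : |(n - σ) / σ * (ind e ⬝ᵥ (W *ᵥ ind e))| ≤ 2 * b * n := by
    rw [abs_mul, abs_of_nonneg (div_nonneg (by linarith) hσ0)]
    rcases hσ0.eq_or_lt with h0 | h0
    · rw [← h0]; simp; positivity
    · calc (n - σ) / σ * |ind e ⬝ᵥ (W *ᵥ ind e)| ≤ (n - σ) / σ * (b * (σ + σ)) := by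
            gcongr
        _ = 2 * b * (n - σ) := by field_simp; ring
        _ ≤ _ := by gcongr; linarith
  refine (abs_sub _ _).trans ?_
  linarith

/-- Once the community has linear size the ratio of sizes is at most 2/κ, and the sharper bound on
0-1 vectors can be used. -/
theorem abs_qEX_noise_le_of_large {W : Matrix (Fin n) (Fin n) ℝ} {b : ℝ} (hκ : 0 < κ) (hn : 0 < n)
    (hW : ∀ s t : Fin n → ℝ, (∀ i, s i = 0 ∨ s i = 1) → (∀ i, t i = 0 ∨ t i = 1) →
      |s ⬝ᵥ (W *ᵥ t)| ≤ b) (he : ∀ i, e i = 1 ∨ e i = -1) (hlarge : κ * n / 2 ≤ ∑ i, ind e i) :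
    |qEX W e| ≤ (2 / κ + 1) * b := by
  have hn0 : (0:ℝ) < n := by positivity
  have hs := ind_zero_or_one he
  have hs' : ∀ i, (1 - ind e : Fin n → ℝ) i = 0 ∨ (1 - ind e : Fin n → ℝ) i = 1 := fun i => by
    rcases hs i with h | h <;> simp [h]
  have h1 := hW (ind e) (ind e) hs hs
  have h2 := hW (ind e) (1 - ind e) hs hs'
  rw [qEX_eq]
  have hσn := sum_le_card_of_zero_or_one hs
  set σ := ∑ i, ind e i
  have hσ0 : 0 < σ := lt_of_lt_of_le (by positivity) hlarge
  have hb : 0 ≤ b := (abs_nonneg _).trans h1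
  have h3 : (n - σ) / σ ≤ 2 / κ := by
    rw [div_le_div_iff₀ hσ0 hκ]
    nlinarith
  have h4 : |(n - σ) / σ * (ind e ⬝ᵥ (W *ᵥ ind e))| ≤ 2 / κ * b := by
    rw [abs_mul, abs_of_nonneg (div_nonneg (by linarith) hσ0.le)]
    gcongr
  refine (abs_sub _ _).trans ?_
  linarith

theorem ncard_ne_le_of_near_competitor {q ε : ℝ} {B : Matrix (Fin n) (Fin n) ℝ} {e' : Fin n → ℝ}
    (hκ : 0 < κ) (hq : 1 ≤ q) (hqκ : 240 ≤ κ ^ 4 * q ^ 5) (hn : 0 < n) (hr₀ : 0 ≤ r)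
    (hr₁ : κ ≤ 1 - r) (h₁ : κ * n ≤ n₁) (h₂ : κ * n ≤ n - n₁)
    (he : ∀ i, e i = 1 ∨ e i = -1) (he' : ∀ i, e' i = 1 ∨ e' i = -1)
    (hbil : ∀ x y, |x ⬝ᵥ ((B - meanMatrix n n₁ (q ^ 20) r) *ᵥ y)|
      ≤ 5 * q ^ 15 * (x ⬝ᵥ x + y ⬝ᵥ y))
    (hcut : ∀ s t : Fin n → ℝ, (∀ i, s i = 0 ∨ s i = 1) → (∀ i, t i = 0 ∨ t i = 1) →
      |s ⬝ᵥ ((B - meanMatrix n n₁ (q ^ 20) r) *ᵥ t)| ≤ 9 * n * q ^ 10)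
    (hmax : qEX B e' ≤ qEX B e) (hε : ({i | e' i ≠ trueLabel n n₁ i}.ncard : ℝ) ≤ n * ε) :
    ({i | e i ≠ trueLabel n n₁ i}.ncard : ℝ) ≤ 108 / κ ^ 4 * n * (ε + (q ^ 10)⁻¹) := by
  have hn0 : (0:ℝ) < n := by positivity
  have hq0 : 0 < q := by linarith
  have hκ1 : κ ≤ 1 := by linarith
  have hle : n₁ ≤ n := by
    have : (0:ℝ) ≤ κ * n := by positivity
    have : (n₁:ℝ) ≤ n := by linarith
    exact_mod_cast this
  have hε0 : 0 ≤ ε := by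
    have : (0:ℝ) ≤ n * ε := (Nat.cast_nonneg _).trans hε
    exact nonneg_of_mul_nonneg_right this hn0
  have hmn := ncard_le (p := fun i => e i ≠ trueLabel n n₁ i)
  have eq1 := ncard_ne_eq (n₁ := n₁) he hle
  have eq2 := ncard_ne_eq (n₁ := n₁) he' hle
  have pass := fun (E : ℝ) => ncard_ne_le_of_qEX_le (B := B) (E := E) hκ
    (show 0 < q ^ 20 by positivity) hn hr₁ h₁ h₂ he he'
  set m : ℝ := ({i | e i ≠ trueLabel n n₁ i}.ncard : ℝ)
  set m' : ℝ := ({i | e' i ≠ trueLabel n n₁ i}.ncard : ℝ)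
  have hinv : 0 ≤ (q ^ 10)⁻¹ := by positivity
  -- For large ε the trivial bound by n is enough.
  rcases le_total (κ ^ 3 / 8) ε with hbig | hsmall
  · calc m ≤ n := hmn
      _ ≤ 108 / κ ^ 3 * n * (κ ^ 3 / 8) := by field_simp; norm_num
      _ ≤ 108 / κ ^ 4 * n * (ε + (q ^ 10)⁻¹) := by
          have : κ ^ 4 ≤ κ ^ 3 := pow_le_pow_of_le_one hκ.le hκ1 (by norm_num)
          gcongr
          linarith
  -- First pass, with noise O(q^15 n): it gives at most κn/2 errors, hence at least n₁ - κn/2 ≥ κn/2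
  -- labels equal to 1.
  · have p1 := pass _ (abs_qEX_noise_le (by positivity) hbil he)
      (abs_qEX_noise_le (by positivity) hbil he') hmax
    have t1 : 2 * (3 * (5 * q ^ 15) * n) / (q ^ 20 * κ) ≤ κ ^ 3 / 8 * n := by
      rw [div_le_iff₀ (by positivity)]
      calc 2 * (3 * (5 * q ^ 15) * n) = 240 * (q ^ 15 * n / 8) := by ring
        _ ≤ (κ ^ 4 * q ^ 5) * (q ^ 15 * n / 8) := by gcongr
        _ = _ := by ring
    have t2 : m' ≤ κ ^ 3 / 8 * n := by
      calc m' ≤ n * ε := hε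
        _ ≤ n * (κ ^ 3 / 8) := by gcongr
        _ = _ := by ring
    have t3 : m ≤ κ * n / 2 := by
      have : κ ^ 2 / 2 * m ≤ κ ^ 2 / 2 * (κ * n / 2) := by linarith
      exact le_of_mul_le_mul_left this (by positivity)
    have t4 : m' ≤ κ * n / 2 := by
      have : κ ^ 3 ≤ κ := by
        simpa using pow_le_pow_of_le_one hκ.le hκ1 (show 1 ≤ 3 by norm_num)
      have : κ ^ 3 * n ≤ κ * n := by gcongr
      have : 0 ≤ κ * n := by positivity
      linarith
    obtain ⟨a1, a2, a3, a4⟩ := ind_bounds (n₁ := n₁) he hle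
    obtain ⟨b1, b2, b3, b4⟩ := ind_bounds (n₁ := n₁) he' hle
    have l1 : κ * n / 2 ≤ ∑ i, ind e i := by linarith
    have l2 : κ * n / 2 ≤ ∑ i, ind e' i := by linarith
    -- Second pass, with noise O(q^10 n), which gives the final rate.
    have p2 := pass _ (abs_qEX_noise_le_of_large hκ hn hcut he l1)
      (abs_qEX_noise_le_of_large hκ hn hcut he' l2) hmax
    have t5 : 2 * ((2 / κ + 1) * (9 * n * q ^ 10)) / (q ^ 20 * κ)
        ≤ 54 / κ ^ 2 * n * (q ^ 10)⁻¹ := by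
      have : 2 / κ + 1 ≤ 3 / κ := by
        rw [div_add_one hκ.ne']
        gcongr
        linarith
      calc _ ≤ 2 * (3 / κ * (9 * n * q ^ 10)) / (q ^ 20 * κ) := by gcongr
        _ = _ := by field_simp; ring
    have t6 : κ ^ 2 / 2 * m ≤ n * ε + 54 / κ ^ 2 * n * (q ^ 10)⁻¹ := by linarith
    have t7 : (n:ℝ) * ε ≤ 54 / κ ^ 2 * n * ε := by
      have : 1 ≤ 54 / κ ^ 2 := by
        rw [one_le_div (by positivity)]
        nlinarith
      calc (n:ℝ) * ε = 1 * n * ε := by ring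
        _ ≤ _ := by gcongr
    have t8 : κ ^ 2 / 2 * m ≤ κ ^ 2 / 2 * (108 / κ ^ 4 * n * (ε + (q ^ 10)⁻¹)) := by
      calc κ ^ 2 / 2 * m ≤ 54 / κ ^ 2 * n * (ε + (q ^ 10)⁻¹) := by linarith
        _ = _ := by field_simp; ring
    exact le_of_mul_le_mul_left t8 (by positivity)

end Criterion

/-! ### Recovery of the labels on the regular event -/

section Recovery

variable {n n₁ : ℕ} {q r lam κ b : ℝ}

theorem meanMatrix_nonneg_form (hlam : 0 ≤ lam) (hr₀ : 0 ≤ r) (hr₁ : r ≤ 1) (x : Fin n → ℝ) :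
    0 ≤ x ⬝ᵥ (meanMatrix n n₁ lam r *ᵥ x) := by
  rw [dotProduct_meanMatrix_mulVec]
  have h1 : 0 ≤ (1 - r) * (chi n n₁ ⬝ᵥ x) * (chi n n₁ ⬝ᵥ x) := by
    rw [mul_assoc]
    exact mul_nonneg (by linarith) (mul_self_nonneg _)
  have h2 : 0 ≤ r * (∑ i, x i) * (∑ i, x i) := by
    rw [mul_assoc]
    exact mul_nonneg hr₀ (mul_self_nonneg _)
  positivity

theorem trueLabel_residual_le {B : Matrix (Fin n) (Fin n) ℝ} {U : Matrix (Fin 2) (Fin n) ℝ}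
    (hκ : 0 < κ) (hlam : 0 < lam) (hn : 0 < n) (hr : κ ≤ r) (hr₁ : κ ≤ 1 - r)
    (h₁ : κ * n ≤ n₁) (h₂ : κ * n ≤ n - n₁) (hB : B.IsSymm) (hU : IsLeadingEigenvectors B U)
    (hb : 0 ≤ b) (hW : ∀ x, |x ⬝ᵥ ((B - meanMatrix n n₁ lam r) *ᵥ x)| ≤ b * (x ⬝ᵥ x))
    (hW' : ∀ x, ((B - meanMatrix n n₁ lam r) *ᵥ x) ⬝ᵥ ((B - meanMatrix n n₁ lam r) *ᵥ x)
      ≤ b ^ 2 * (x ⬝ᵥ x)) :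
    (trueLabel n n₁ - Uᵀ *ᵥ (U *ᵥ trueLabel n n₁)) ⬝ᵥ
      (trueLabel n n₁ - Uᵀ *ᵥ (U *ᵥ trueLabel n n₁)) ≤ 32 / κ ^ 5 * b ^ 2 * n / lam ^ 2 := by
  obtain ⟨z, hz, hzz⟩ := exists_preimage_trueLabel hκ hlam hn hr hr₁ h₁ h₂
  have hker : ∀ x, chi n n₁ ⬝ᵥ x = 0 → (1 : Fin n → ℝ) ⬝ᵥ x = 0 →
      meanMatrix n n₁ lam r *ᵥ x = 0 := by
    intro x hx1 hx2
    rw [one_dotProduct] at hx2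
    ext i
    rw [meanMatrix_mulVec, hx1, hx2]
    simp
  have h := mulVec_residual_le hB hU (add_sub_cancel (meanMatrix n n₁ lam r) B).symm hb hW
    (meanMatrix_nonneg_form hlam.le (by linarith) (by linarith)) hker z
  rw [hz] at h
  refine h.trans ?_
  calc _ ≤ 2 * b ^ 2 * (z ⬝ᵥ z) + 2 * (b ^ 2 * (z ⬝ᵥ z)) := by gcongr; exact hW' z
    _ = 4 * b ^ 2 * (z ⬝ᵥ z) := by ring
    _ ≤ 4 * b ^ 2 * (8 / κ ^ 5 * n / lam ^ 2) := by gcongr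
    _ = _ := by ring

theorem transpose_mulVec_dotProduct_le {m : ℕ} (D : Matrix (Fin m) (Fin n) ℝ) (u : Fin m → ℝ) :
    (Dᵀ *ᵥ u) ⬝ᵥ (Dᵀ *ᵥ u) ≤ ‖D‖ ^ 2 * (u ⬝ᵥ u) := by
  have hn : ∀ {k : ℕ} (v : Fin k → ℝ), v ⬝ᵥ v = ‖WithLp.toLp 2 v‖ ^ 2 := fun v => by
    rw [EuclideanSpace.norm_sq_eq, dotProduct_eq_sum_sq]
    simp only [norm_eq_abs, sq_abs]
  have h := Matrix.l2_opNorm_mulVec Dᵀ (WithLp.toLp 2 u)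
  have hD : ‖Dᵀ‖ = ‖D‖ := by
    rw [← Matrix.l2_opNorm_conjTranspose D, Matrix.conjTranspose_eq_transpose_of_trivial]
  rw [hD] at h
  rw [hn, hn, ← mul_pow]
  exact pow_le_pow_left₀ (norm_nonneg _) h 2

/-- The error bounds for the maximizers of the extraction criterion, for an adjacency matrix `B`
whose noise is regular and for the leading eigenvectors `V` of a matrix `EB` that agrees with the
mean matrix off the diagonal. -/
theorem recovery_of_isRegular {B EB : Matrix (Fin n) (Fin n) ℝ} {V U : Matrix (Fin 2) (Fin n) ℝ}
    {e : Fin n → ℝ} (hκ : 0 < κ) (hq : 1 ≤ q) (hqκ : 240 ≤ κ ^ 4 * q ^ 5)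
    (hg : ∃ g : ℕ, 4 * (g:ℝ) + 3 ≤ q ∧ q ^ 7 ≤ 2 ^ g) (hn : 0 < n)
    (hr : κ ≤ r) (hr₁ : κ ≤ 1 - r) (h₁ : κ * n ≤ n₁) (h₂ : κ * n ≤ n - n₁)
    (hB : B.IsSymm) (hD : ∀ i, |B i i - meanMatrix n n₁ (q ^ 20) r i i| ≤ 1)
    (hreg : IsRegular q (lowerPart B (meanMatrix n n₁ (q ^ 20) r)))
    {D : Fin n → ℝ} (hEB : EB - meanMatrix n n₁ (q ^ 20) r = Matrix.diagonal D)
    (hD1 : ∀ i, |D i| ≤ 1) (hV : IsLeadingEigenvectors EB V) (he : IsExtremeMaximizer B U e) :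
    ({i | e i ≠ trueLabel n n₁ i}.ncard : ℝ)
        ≤ 108 / κ ^ 4 * (3200 / κ ^ 5 + 2) * n * ((q ^ 10)⁻¹ + ‖U - V‖) ∧
      (IsLeadingEigenvectors B U → ({i | e i ≠ trueLabel n n₁ i}.ncard : ℝ)
        ≤ 108 / κ ^ 4 * (3200 / κ ^ 5 + 2) * n * (q ^ 10)⁻¹) := by
  have hq0 : 0 < q := by linarith
  have hn0 : (0:ℝ) < n := by positivity
  have hκ1 : κ ≤ 1 := by linarith
  have hr0 : 0 ≤ r := by linarith
  have hQ : 0 ≤ (q ^ 10)⁻¹ := by positivity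
  have hbil := abs_noise_bilin_le hq hg hB meanMatrix_isSymm hD hreg
  have hcut := fun s t : Fin n → ℝ => abs_noise_cut_le (s := s) (t := t) hq hB meanMatrix_isSymm
    hD hreg
  have hc : ∀ i, trueLabel n n₁ i = 1 ∨ trueLabel n n₁ i = -1 := trueLabel_eq_or
  -- It remains to find u with `Uᵀ *ᵥ u` close to c: `V *ᵥ c` for the first bound, `U *ᵥ c` for the
  -- second.
  have main : ∀ (u : Fin 2 → ℝ) (ε : ℝ),
      (trueLabel n n₁ - Uᵀ *ᵥ u) ⬝ᵥ (trueLabel n n₁ - Uᵀ *ᵥ u) ≤ n * ε →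
      ({i | e i ≠ trueLabel n n₁ i}.ncard : ℝ) ≤ 108 / κ ^ 4 * n * (ε + (q ^ 10)⁻¹) := by
    intro u ε hu
    obtain ⟨e', he', hnear⟩ := exists_extremeLabel_near U u hc
    exact ncard_ne_le_of_near_competitor hκ hq hqκ hn hr0 hr₁ h₁ h₂ he.1.1 he'.1 hbil hcut
      (he.2 e' he') (hnear.trans hu)
  constructor
  · rcases le_total 1 ‖U - V‖ with hη | hη
    · have hC : 1 ≤ 108 / κ ^ 4 * (3200 / κ ^ 5 + 2) := by
        have : 1 ≤ 108 / κ ^ 4 := by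
          rw [one_le_div (by positivity)]
          linarith [pow_le_one₀ hκ.le hκ1 (n := 4)]
        have : 0 ≤ 3200 / κ ^ 5 := by positivity
        nlinarith
      calc _ ≤ (n:ℝ) := ncard_le
        _ = 1 * n * (0 + 1) := by ring
        _ ≤ _ := by gcongr
    · have hEBs : EB.IsSymm := by
        have : EB = Matrix.diagonal D + meanMatrix n n₁ (q ^ 20) r := by rw [← hEB]; abel
        rw [this]
        exact (Matrix.isSymm_diagonal D).add meanMatrix_isSymm
      have hres := trueLabel_residual_le (b := 1) hκ (show 0 < q ^ 20 by positivity) hn hr hr₁ h₁ h₂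
        hEBs hV zero_le_one
        (fun x => by
          have h := abs_diag_bilin_le hD1 x x
          have e1 : x ⬝ᵥ (Matrix.diagonal D *ᵥ x) = ∑ i, x i * D i * x i := by
            refine Finset.sum_congr rfl fun i _ => ?_
            rw [Matrix.mulVec_diagonal]; ring
          rw [hEB, e1]
          linarith)
        (fun x => by
          rw [hEB, one_pow, one_mul, dotProduct_eq_sum_sq, dotProduct_eq_sum_sq]
          refine Finset.sum_le_sum fun i _ => ?_
          rw [Matrix.mulVec_diagonal, mul_pow]
          have h1 := (sq_le_one_iff_abs_le_one _).2 (hD1 i)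
          nlinarith [sq_nonneg (x i)])
      set c := trueLabel n n₁
      have hsplit : c - Uᵀ *ᵥ (V *ᵥ c) = (c - Vᵀ *ᵥ (V *ᵥ c)) - (U - V)ᵀ *ᵥ (V *ᵥ c) := by
        rw [Matrix.transpose_sub, Matrix.sub_mulVec]; abel
      have hcc : c ⬝ᵥ c = n := by
        rw [dotProduct_eq_sum_sq]
        have : ∀ i, c i ^ 2 = 1 := fun i => by rcases hc i with h | h <;> simp [c, h]
        simp [this]
      have hVc : (V *ᵥ c) ⬝ᵥ (V *ᵥ c) ≤ n := by
        have h1 := residual_dotProduct_self_le hV.orthonormal c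
        have h2 := dotProduct_self_nonneg' (c - Vᵀ *ᵥ (V *ᵥ c))
        linarith
      have hηn : 0 ≤ ‖U - V‖ := norm_nonneg _
      have hη2 : ‖U - V‖ ^ 2 ≤ ‖U - V‖ := by nlinarith
      have h40 : ((q ^ 20) ^ 2)⁻¹ ≤ (q ^ 10)⁻¹ := by
        rw [← pow_mul]
        gcongr
        norm_num
      have hu : (c - Uᵀ *ᵥ (V *ᵥ c)) ⬝ᵥ (c - Uᵀ *ᵥ (V *ᵥ c))
          ≤ n * (64 / κ ^ 5 * (q ^ 10)⁻¹ + 2 * ‖U - V‖) := by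
        rw [hsplit]
        refine (sub_dotProduct_sub_le _ _).trans ?_
        have h3 := transpose_mulVec_dotProduct_le (U - V) (V *ᵥ c)
        have h4 : ‖U - V‖ ^ 2 * ((V *ᵥ c) ⬝ᵥ (V *ᵥ c)) ≤ ‖U - V‖ * n :=
          mul_le_mul hη2 hVc (dotProduct_self_nonneg' _) hηn
        have h5 : 32 / κ ^ 5 * 1 ^ 2 * n / (q ^ 20) ^ 2 ≤ 32 / κ ^ 5 * 1 ^ 2 * n * (q ^ 10)⁻¹ := by
          rw [div_eq_mul_inv]
          gcongr
        have h6 : (n:ℝ) * (64 / κ ^ 5 * (q ^ 10)⁻¹ + 2 * ‖U - V‖)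
            = 2 * (32 / κ ^ 5 * 1 ^ 2 * n * (q ^ 10)⁻¹) + 2 * (‖U - V‖ * n) := by ring
        rw [h6]
        exact add_le_add (mul_le_mul_of_nonneg_left (hres.trans h5) zero_le_two)
          (mul_le_mul_of_nonneg_left (h3.trans h4) zero_le_two)
      refine (main _ _ hu).trans ?_
      have h6 : 64 / κ ^ 5 ≤ 3200 / κ ^ 5 := by gcongr; norm_num
      have h7 : 0 ≤ 3200 / κ ^ 5 := by positivity
      calc 108 / κ ^ 4 * n * (64 / κ ^ 5 * (q ^ 10)⁻¹ + 2 * ‖U - V‖ + (q ^ 10)⁻¹)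
          ≤ 108 / κ ^ 4 * n * ((3200 / κ ^ 5 + 2) * ((q ^ 10)⁻¹ + ‖U - V‖)) := by
            gcongr
            nlinarith
        _ = _ := by ring
  · intro hU
    -- With b of order λ^(3/4), b²/λ² is of order λ^(-1/2): the spectral bound is just strong
    -- enough.
    have hres := trueLabel_residual_le (b := 10 * q ^ 15) hκ (show 0 < q ^ 20 by positivity) hn hr
      hr₁ h₁ h₂ hB hU (by positivity)
      (fun x => (hbil x x).trans_eq (by ring))
      (fun x => (noise_mulVec_le (by positivity) hbil x).trans_eq (by ring))
    refine (main _ (3200 / κ ^ 5 * (q ^ 10)⁻¹) (hres.trans_eq ?_)).trans ?_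
    · field_simp
      norm_num
    · calc 108 / κ ^ 4 * n * (3200 / κ ^ 5 * (q ^ 10)⁻¹ + (q ^ 10)⁻¹)
          ≤ 108 / κ ^ 4 * n * ((3200 / κ ^ 5 + 2) * (q ^ 10)⁻¹) := by
            gcongr
            linarith
        _ = _ := by ring

end Recovery

/-! ### The probability of the regular event and the asymptotic regime -/

theorem expMatrix_sub_meanMatrix {Ω : Type*} [MeasurableSpace Ω] {μ : Measure Ω}
    [IsProbabilityMeasure μ] {n n₁ : ℕ} {lam r : ℝ} (hlam : 0 ≤ lam) (hlamn : lam ≤ n)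
    (hn : 0 < n) (hr₀ : 0 ≤ r) (hr₁ : r ≤ 1) {A : Ω → Matrix (Fin n) (Fin n) ℝ}
    (hA : IsSBM μ (blockProb n lam r r) (community n n₁) A) :
    ∃ D : Fin n → ℝ, expMatrix μ A - meanMatrix n n₁ lam r = Matrix.diagonal D ∧
      ∀ i, |D i| ≤ 1 := by
  have hn0 : (0:ℝ) < n := by positivity
  have hlow : ∀ i j, j < i → ∫ ω, A ω i j ∂μ = meanMatrix n n₁ lam r i j := fun i j hij =>
    (integral_of_zero_or_one (hA.measurable i j) (fun ω => hA.zero_or_one ω i j)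
      (meanMatrix_nonneg hlam hr₀ i j) (hA.prob i j hij)).2
  refine ⟨fun i => ∫ ω, A ω i i ∂μ - meanMatrix n n₁ lam r i i, ?_, fun i => ?_⟩
  · ext i j
    rw [Matrix.sub_apply, expMatrix, Matrix.of_apply, Matrix.diagonal_apply]
    rcases lt_trichotomy i j with h | h | h
    · rw [if_neg h.ne, ← meanMatrix_isSymm.apply i j, ← hlow j i h, sub_eq_zero]
      exact integral_congr_ae (ae_of_all _ fun ω => (hA.symm ω).apply j i)
    · subst h; simp
    · rw [if_neg h.ne', hlow i j h, sub_self]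
  · have h0 : 0 ≤ ∫ ω, A ω i i ∂μ := integral_nonneg fun ω => by
      rcases hA.zero_or_one ω i i with h | h <;> simp [h]
    have h1 : ∫ ω, A ω i i ∂μ ≤ 1 := by
      calc ∫ ω, A ω i i ∂μ ≤ ∫ _ω, (1:ℝ) ∂μ := by
            refine integral_mono_of_nonneg (ae_of_all _ fun ω => ?_) (integrable_const 1)
              (ae_of_all _ fun ω => ?_) <;>
            rcases hA.zero_or_one ω i i with h | h <;> simp [h]
        _ = 1 := by simp
    have h2 := meanMatrix_nonneg (n₁ := n₁) hlam hr₀ i i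
    have h3 := (meanMatrix_le (n₁ := n₁) hlam hr₁ i i).trans ((div_le_one hn0).2 hlamn)
    rw [abs_le]
    constructor <;> linarith

/-- `g` is 7 log₂ q rounded up, and 4g + 3 ≤ 56 log q + 7. -/
theorem exists_level_cutoff {q : ℝ} (hq1 : 1 ≤ q) (hq : 32 * (1 + 20 * log q) ≤ q) :
    ∃ g : ℕ, 4 * (g:ℝ) + 3 ≤ q ∧ q ^ 7 ≤ 2 ^ g := by
  have hq0 : 0 < q := by linarith
  have hl : 0 ≤ log q := log_nonneg hq1
  have hl2 := log_two_gt_d9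
  refine ⟨⌈7 * log q / log 2⌉₊, ?_, ?_⟩
  · have h1 : 7 * log q / log 2 ≤ 14 * log q := by
      rw [div_le_iff₀ (by linarith)]
      nlinarith
    have h2 := Nat.ceil_lt_add_one (show 0 ≤ 7 * log q / log 2 by positivity)
    linarith
  · have h1 := Nat.le_ceil (7 * log q / log 2)
    rw [div_le_iff₀ (by linarith)] at h1
    rw [← log_le_log_iff (by positivity) (by positivity), log_pow, log_pow]
    exact_mod_cast h1

theorem eventually_log_le : ∀ᶠ q : ℝ in atTop, 32 * (1 + 20 * log q) ≤ q := by
  have h := isLittleO_log_id_atTop.def (show (0:ℝ) < 1 / 1280 by norm_num)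
  filter_upwards [h, eventually_ge_atTop 64] with q h1 h2
  rw [id, norm_eq_abs, norm_eq_abs, abs_of_nonneg (by linarith : (0:ℝ) ≤ q)] at h1
  linarith [le_abs_self (log q)]

/-- Only subadditivity is used, so neither set has to be measurable. -/
theorem le_measure_of_forall_mem {Ω : Type*} [MeasurableSpace Ω] {μ : Measure Ω}
    [IsProbabilityMeasure μ] {G : Ω → Prop} {S : Set Ω} {a : ℝ} (hG : μ.real {ω | ¬ G ω} ≤ a)
    (hS : ∀ ω, G ω → ω ∈ S) : ENNReal.ofReal (1 - a) ≤ μ S := by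
  rw [← ofReal_measureReal]
  apply ENNReal.ofReal_le_ofReal
  have h1 : μ.real (S ∪ {ω | ¬ G ω}) = 1 := by
    rw [← probReal_univ (μ := μ)]
    congr 1
    ext ω
    simp only [Set.mem_union, Set.mem_ofPred_eq, Set.mem_univ, iff_true]
    by_cases h : G ω
    · exact Or.inl (hS ω h)
    · exact Or.inr h
  linarith [measureReal_union_le (μ := μ) S {ω | ¬ G ω}]

end CommExtract

/-! ### The main theorem -/

open CommExtract
theorem theorem5 (r π₁ π₂ δ : ℝ) (hr₀ : 0 < r) (hr₁ : r < 1)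
    (hπ₁ : 0 < π₁) (hπ₂ : 0 < π₂) (hπ : π₁ + π₂ = 1) (hδ₀ : 0 < δ) (hδ₁ : δ < 1) :
    ∃ M : ℝ, 0 < M ∧
      ∀ lam : ℕ → ℝ,
        (∃ C : ℝ, 0 < C ∧ ∀ᶠ n : ℕ in atTop, C * Real.log n ≤ lam n) →
        (∀ᶠ n : ℕ in atTop, lam n ≤ n) →
        ∀ᶠ n : ℕ in atTop, ∀ n₁ : ℕ, |(n₁ : ℝ) - n * π₁| < 1 →
          ∀ (Ω : Type*) [MeasurableSpace Ω] (μ : Measure Ω) [IsProbabilityMeasure μ]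
            (A : Ω → Matrix (Fin n) (Fin n) ℝ),
            IsSBM μ (blockProb n (lam n) r r) (community n n₁) A →
            ∀ UEA : Matrix (Fin 2) (Fin n) ℝ, IsLeadingEigenvectors (expMatrix μ A) UEA →
              ENNReal.ofReal (1 - (n : ℝ) ^ (-δ)) ≤
                μ {ω | ∀ (UA : Matrix (Fin 2) (Fin n) ℝ) (e : Fin n → ℝ),
                  IsExtremeMaximizer (A ω) UA e →
                    (1 / (n : ℝ)) * ‖WithLp.toLp 2 (trueLabel n n₁ - e)‖ ^ 2
                        ≤ M * ((lam n) ^ (-(1 / 2) : ℝ) + ‖UA - UEA‖) ∧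
                    (IsLeadingEigenvectors (A ω) UA →
                      ({i | e i ≠ trueLabel n n₁ i}.ncard : ℝ) / n ≤ M / √(lam n))} := by
  -- One lower bound for all the model constants. The halves of π₁ and π₂ absorb the rounding of n₁.
  set κ : ℝ := min (min (π₁ / 2) (π₂ / 2)) (min r (1 - r)) with hκdef
  have hκ : 0 < κ := lt_min (lt_min (by linarith) (by linarith)) (lt_min hr₀ (by linarith))
  have hκ1 : κ ≤ π₁ / 2 := (min_le_left _ _).trans (min_le_left _ _)
  have hκ2 : κ ≤ π₂ / 2 := (min_le_left _ _).trans (min_le_right _ _)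
  have hκ3 : κ ≤ r := (min_le_right _ _).trans (min_le_left _ _)
  have hκ4 : κ ≤ 1 - r := (min_le_right _ _).trans (min_le_right _ _)
  set M₀ : ℝ := 108 / κ ^ 4 * (3200 / κ ^ 5 + 2) with hM₀
  have hM₀pos : 0 < M₀ := by positivity
  refine ⟨4 * M₀, by positivity, fun lam ⟨C, hC, hClam⟩ hlamn => ?_⟩
  set q : ℕ → ℝ := fun n => lam n ^ (1 / 20 : ℝ) with hq
  have hlog : Tendsto (fun n : ℕ => Real.log n) atTop atTop :=
    Real.tendsto_log_atTop.comp tendsto_natCast_atTop_atTop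
  have hlam : Tendsto lam atTop atTop :=
    tendsto_atTop_mono' _ hClam (hlog.const_mul_atTop hC)
  have hqt : Tendsto q atTop atTop := (tendsto_rpow_atTop (by norm_num)).comp hlam
  have hq5 : Tendsto (fun q : ℝ => κ ^ 4 * q ^ 5) atTop atTop :=
    (tendsto_pow_atTop (by norm_num)).const_mul_atTop (by positivity)
  filter_upwards [hClam, hlamn, hlam.eventually_gt_atTop 0, hqt.eventually_ge_atTop 4,
    hqt.eventually eventually_log_le, hqt.eventually (hq5.eventually_ge_atTop 240),
    hqt.eventually_ge_atTop (16 / C), eventually_ge_atTop 8,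
    tendsto_natCast_atTop_atTop.eventually_ge_atTop (2 / π₁),
    tendsto_natCast_atTop_atTop.eventually_ge_atTop (2 / π₂)]
    with n hCn hlamn hlam0 hq4 hqlog hq5 hqC hn8 hnπ₁ hnπ₂ n₁ hn₁ Ω _ μ _ A hA UEA hUEA
  have hn : 0 < n := by lia
  have hn0 : (0:ℝ) < n := by exact_mod_cast hn
  have hn1 : (1:ℝ) ≤ n := by exact_mod_cast hn
  have hq0 : 0 < q n := by linarith
  have hq20 : q n ^ 20 = lam n := by
    simp only [hq]
    rw [← Real.rpow_natCast, ← Real.rpow_mul hlam0.le]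
    norm_num
  have hq10 : (q n ^ 10)⁻¹ = lam n ^ (-(1 / 2) : ℝ) := by
    rw [Real.rpow_neg hlam0.le]
    simp only [hq]
    rw [← Real.rpow_natCast, ← Real.rpow_mul hlam0.le]
    norm_num
  have hsqrt : √(lam n) = q n ^ 10 := by
    rw [← hq20, show q n ^ 20 = (q n ^ 10) ^ 2 by ring]
    exact Real.sqrt_sq (by positivity)
  -- The constant `C` is absorbed by the extra factor `q n`, which tends to infinity; so `M` does
  -- not depend on `C`.
  have hq21 : 16 * Real.log n ≤ q n ^ 21 := by
    have h1 : 16 ≤ q n * C := by rwa [div_le_iff₀ hC] at hqC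
    have h0 : 0 ≤ Real.log n := Real.log_natCast_nonneg n
    calc 16 * Real.log n ≤ q n * C * Real.log n := by gcongr
      _ = q n * (C * Real.log n) := by ring
      _ ≤ q n * lam n := by gcongr
      _ = q n ^ 21 := by rw [← hq20]; ring
  rw [abs_lt] at hn₁
  have hk1 : κ * n ≤ n₁ := by
    have : 2 ≤ n * π₁ := by rwa [div_le_iff₀ hπ₁] at hnπ₁
    have : κ * n ≤ π₁ / 2 * n := by gcongr
    linarith
  have hk2 : κ * n ≤ n - n₁ := by
    have h2 : 2 ≤ n * π₂ := by rwa [div_le_iff₀ hπ₂] at hnπ₂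
    have h3 : κ * n ≤ π₂ / 2 * n := by gcongr
    have h4 : (n:ℝ) * π₁ + n * π₂ = n := by rw [← mul_add, hπ, mul_one]
    linarith
  have hle : n₁ ≤ n := by
    have h5 : (0:ℝ) ≤ κ * n := by positivity
    have h6 : (n₁:ℝ) ≤ n := by linarith
    exact_mod_cast h6
  obtain ⟨D, hD, hD1⟩ := expMatrix_sub_meanMatrix hlam0.le hlamn hn hr₀.le hr₁.le hA
  rw [← hq20] at hA hD
  have hprob := prob_not_isRegular_le hq4 hqlog hr₀.le hr₁.le hn8 hq21 hA
  have hnδ : (n:ℝ)⁻¹ ≤ (n:ℝ) ^ (-δ) := by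
    rw [← Real.rpow_neg_one]
    exact Real.rpow_le_rpow_of_exponent_le hn1 (by linarith)
  refine le_measure_of_forall_mem (hprob.trans hnδ) fun ω hω UA e he => ?_
  have hdiag : ∀ i, |A ω i i - meanMatrix n n₁ (q n ^ 20) r i i| ≤ 1 := by
    intro i
    have h2 := meanMatrix_nonneg (n₁ := n₁) (hq20 ▸ hlam0.le : 0 ≤ q n ^ 20) hr₀.le i i
    have h3 := (meanMatrix_le (n₁ := n₁) (hq20 ▸ hlam0.le : 0 ≤ q n ^ 20) hr₁.le i i).trans
      ((div_le_one hn0).2 (hq20 ▸ hlamn))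
    rw [abs_le]
    rcases hA.zero_or_one ω i i with h | h <;> rw [h] <;> constructor <;> linarith
  obtain ⟨b1, b2⟩ := recovery_of_isRegular hκ (by linarith) hq5
    (exists_level_cutoff (by linarith) hqlog) hn hκ3 hκ4 hk1 hk2 (hA.symm ω) hdiag hω hD hD1
    hUEA he
  refine ⟨?_, fun hU => ?_⟩
  -- Each wrong label contributes 2² = 4 to the squared distance, whence the 4 in `M`.
  · rw [norm_trueLabel_sub_sq he.1.1 hle, ← hq10]
    calc _ ≤ 1 / (n:ℝ) * (4 * (M₀ * n * ((q n ^ 10)⁻¹ + ‖UA - UEA‖))) := by gcongr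
      _ = _ := by field_simp
  · rw [hsqrt, div_le_iff₀ hn0]
    refine (b2 hU).trans ?_
    have h7 : 0 ≤ M₀ * n * (q n ^ 10)⁻¹ := by positivity
    calc M₀ * n * (q n ^ 10)⁻¹ ≤ 4 * (M₀ * n * (q n ^ 10)⁻¹) := by linarith
      _ = _ := by ring
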